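/- **Setting.** An instance of the Node-Robust Assignment Problem (V-RAP) is a triple $(G,\mathcal F,c)$, where $G=(U\,\dot\cup\,W,E)$ is a finite simple bipartite graph with $|U|\le|W|$ (jobs $U$, machines $W$), $\mathcal F\subseteq W$ is the set of vulnerable machines and $c\in\mathbb R_{\ge0}^W$. A set $X\subseteq W$ is a *node-robust solution* if for every $f\in\mathcal F$ the graph $G[U\cup X]-f$ contains a $U$-perfect matching, i.e. a set of pairwise non-adjacent edges covering all of $U$. The goal is to minimise $c(X)=\sum_{w\in X}c_w$ over the node-robust solutions. An instance is *feasible* if it has a node-robust solution, and *uniform* if $\mathcal F=W$; card-V-RAP is the case $c_w=1$ for all $w\in W$. An *$\alpha$-approximate solution* is a node-robust solution $X$ with $c(X)\le\alpha\,c(Y)$ for every node-robust solution $Y$. **Algorithm.** Given a feasible uniform instance of card-V-RAP, take any $U$-perfect matching $M$ of $G$, let $W^M\subseteq W$ be the set of machines covered by $M$, and for $w\in W\setminus W^M$ let $R_w$ be the set of all $u\in U$ for which $G[U\cup W^M\cup\{w\}]$ contains an $M$-alternating $u$-$w$-path. Start with $X:=W^M$ and $T:=U$. While $T\neq\emptyset$,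 choose $w\in W\setminus X$ for which $|R_w\cap T|$ is maximum (ties broken arbitrarily), and replace $T$ by $T\setminus R_w$ and $X$ by $X\cup\{w\}$. Return $X$. **Theorem.** Uniform card-V-RAP admits a polynomial-time $1.75$-approximation algorithm. More precisely: 1. for every feasible uniform instance of card-V-RAP, every possible output of the algorithm above (for every choice of $M$ and every tie-breaking) is a $1.75$-approximate solution; 2. the algorithm can be implemented in polynomial time: there are a random access machine program (unit-cost variables, arrays, addition, truncated subtraction, comparisons, no multiplication) and a polynomial $q$ such that on every feasible uniform instance of card-V-RAP, given by the adjacency matrix of $G$ and the indicator vector of $\mathcal F$, the program halts after at most $q(|U|+|W|)$ steps with a possible output of the algorithm above; in particular it returns a $1.75$-approximate solution. -/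

import Mathlib

namespace NodeRobust

/-! ## The node-robust assignment problem -/

/-- An instance `(G, F, c)` of the Node-Robust Assignment Problem. The bipartite graph `G` has the
job nodes `U = Fin jobs` and the machine nodes `W = Fin machines`, with `|U| ≤ |W|`; `adj u w` says
whether `{u, w}` is an edge; `vulnerable` is the set `F ⊆ W`; `cost` is the cost vector. -/
structure VRAP where
  jobs : ℕ
  machines : ℕ
  jobs_le_machines : jobs ≤ machines
  adj : Fin jobs → Fin machines → Bool
  vulnerable : Finset (Fin machines)
  cost : Fin machines → NNReal

namespace VRAP

/-- Every machine is vulnerable. -/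
def IsUniform (I : VRAP) : Prop := I.vulnerable = Finset.univ

/-- All machine costs are one: the cardinality version of the problem. -/
def HasUnitCosts (I : VRAP) : Prop := ∀ w, I.cost w = 1

/-- `μ` is a `U`-perfect matching of `G[U ∪ X]`: a set of pairwise non-adjacent edges that covers
every job, written as the function that sends a job to its partner. -/
def IsPerfectMatching (I : VRAP) (X : Finset (Fin I.machines))
    (μ : Fin I.jobs → Fin I.machines) : Prop :=
  Function.Injective μ ∧ ∀ u, I.adj u (μ u) = true ∧ μ u ∈ X

/-- `X` is a node-robust solution: for every vulnerable `f`, the graph `G[U ∪ X] - f` contains a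
`U`-perfect matching. -/
def IsRobust (I : VRAP) (X : Finset (Fin I.machines)) : Prop :=
  ∀ f ∈ I.vulnerable, ∃ μ, I.IsPerfectMatching (X.erase f) μ

/-- The instance has a node-robust solution. -/
def IsFeasible (I : VRAP) : Prop := ∃ X, I.IsRobust X

/-- The cost `c(X)`. -/
def totalCost (I : VRAP) (X : Finset (Fin I.machines)) : NNReal := ∑ w ∈ X, I.cost w

/-- `X` is a node-robust solution of cost at most `α` times the minimum cost. -/
def IsApproxSolution (I : VRAP) (α : NNReal) (X : Finset (Fin I.machines)) : Prop :=
  I.IsRobust X ∧ ∀ Y, I.IsRobust Y → I.totalCost X ≤ α * I.totalCost Y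

/-! ## The matching-and-greedy-cover algorithm -/

/-- The bipartite graph `G = (U ∪ W, E)`. -/
def graph (I : VRAP) : SimpleGraph (Fin I.jobs ⊕ Fin I.machines) :=
  SimpleGraph.fromRel fun a b => ∃ u w, a = Sum.inl u ∧ b = Sum.inr w ∧ I.adj u w = true

/-- The edge set of the matching `μ`. -/
def matchingEdges (I : VRAP) (μ : Fin I.jobs → Fin I.machines) :
    Set (Sym2 (Fin I.jobs ⊕ Fin I.machines)) :=
  Set.range fun u => s(Sum.inl u, Sum.inr (μ u))

/-- `p` is a path whose edges alternate between edges of `M` and edges outside `M`. -/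
def IsAlternatingPath (I : VRAP) (M : Set (Sym2 (Fin I.jobs ⊕ Fin I.machines)))
    {a b : Fin I.jobs ⊕ Fin I.machines} (p : I.graph.Walk a b) : Prop :=
  p.IsPath ∧ p.edges.IsChain fun e e' => (e ∈ M ↔ e' ∉ M)

open Classical in
/-- The set `R_w` of all jobs `u` for which `G[U ∪ W^M ∪ {w}]` contains an `M`-alternating
`u`-`w`-path, where `M` is the matching `μ` and `W^M` the set of machines covered by it. -/
noncomputable def coverSet (I : VRAP) (μ : Fin I.jobs → Fin I.machines)
    (w : Fin I.machines) : Finset (Fin I.jobs) :=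
  Finset.univ.filter fun u => ∃ p : I.graph.Walk (Sum.inl u) (Sum.inr w),
    I.IsAlternatingPath (I.matchingEdges μ) p ∧
      ∀ w', Sum.inr w' ∈ p.support → w' ∈ Set.range μ ∨ w' = w

/-- `GreedyCover R T X Y`: with uncovered jobs `T` and chosen machines `X`, the greedy loop
can terminate with the set `Y`. As long as `T` is non-empty, a machine `w` outside
`X` for which `|R w ∩ T|` is maximum is chosen (ties are broken arbitrarily). -/
inductive GreedyCover {m n : ℕ} (R : Fin n → Finset (Fin m)) :
    Finset (Fin m) → Finset (Fin n) → Finset (Fin n) → Prop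
  | done (X : Finset (Fin n)) : GreedyCover R ∅ X X
  | step (T : Finset (Fin m)) (X Y : Finset (Fin n)) (w : Fin n) (hT : T.Nonempty) (hw : w ∉ X)
      (hmax : ∀ w', w' ∉ X → (R w' ∩ T).card ≤ (R w ∩ T).card)
      (h : GreedyCover R (T \ R w) (insert w X) Y) : GreedyCover R T X Y

/-- `X` is a possible output of the algorithm for uniform instances with unit costs: take any
`U`-perfect matching, choose the machines covered by it, and extend them by the greedy cover of
the set `U` of all jobs. -/
def IsGreedyOutput (I : VRAP) (X : Finset (Fin I.machines)) : Prop :=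
  ∃ μ, I.IsPerfectMatching Finset.univ μ ∧
    GreedyCover (I.coverSet μ) Finset.univ (Finset.univ.image μ) X

end VRAP

/-! ## Random access machines

Structured programs over natural numbers with variables, arrays (indirect addressing), addition,
truncated subtraction and comparisons; there is no multiplication. Every operation counts as one
step, so that polynomial time agrees with polynomial time on Turing machines. -/

/-- A memory: the contents of the variables and of the arrays. -/
structure Memory where
  var : ℕ → ℕ
  arr : ℕ → ℕ → ℕ

/-- Expressions; `cell a e` is the entry of the array `a` at index `e`. -/
inductive Expr
  | const (k : ℕ)
  | var (x : ℕ)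
  | cell (a : ℕ) (e : Expr)
  | add (e e' : Expr)
  | sub (e e' : Expr)
  | eq (e e' : Expr)
  | lt (e e' : Expr)

namespace Expr

/-- The value of an expression; comparisons give `1` or `0`. -/
def value (s : Memory) : Expr → ℕ
  | const k => k
  | var x => s.var x
  | cell a e => s.arr a (e.value s)
  | add e e' => e.value s + e'.value s
  | sub e e' => e.value s - e'.value s
  | eq e e' => if e.value s = e'.value s then 1 else 0
  | lt e e' => if e.value s < e'.value s then 1 else 0

/-- The number of steps for the evaluation of an expression: one for each operation in it. -/
def steps : Expr → ℕ
  | const _ => 1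
  | var _ => 1
  | cell _ e => e.steps + 1
  | add e e' => e.steps + e'.steps + 1
  | sub e e' => e.steps + e'.steps + 1
  | eq e e' => e.steps + e'.steps + 1
  | lt e e' => e.steps + e'.steps + 1

end Expr

/-- Programs: do nothing; assign `e` to the variable `x`; store `e` in the array `a` at the index
given by `i`; sequential composition; branching and looping, where a non-zero value means true. -/
inductive Prog
  | skip
  | assign (x : ℕ) (e : Expr)
  | store (a : ℕ) (i e : Expr)
  | seq (p q : Prog)
  | ite (e : Expr) (p q : Prog)
  | loop (e : Expr) (p : Prog)

/-- `Runs p s s' t`: started in the memory `s`, the program `p` halts in the memory `s'` after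
exactly `t` steps. -/
inductive Runs : Prog → Memory → Memory → ℕ → Prop
  | skip (s : Memory) : Runs Prog.skip s s 1
  | assign (x : ℕ) (e : Expr) (s : Memory) :
      Runs (Prog.assign x e) s { s with var := Function.update s.var x (e.value s) } (e.steps + 1)
  | store (a : ℕ) (i e : Expr) (s : Memory) :
      Runs (Prog.store a i e) s
        { s with arr := Function.update s.arr a
                          (Function.update (s.arr a) (i.value s) (e.value s)) }
        (i.steps + e.steps + 1)
  | seq {p q : Prog} {s s' s'' : Memory} {t t' : ℕ} (hp : Runs p s s' t) (hq : Runs q s' s'' t') :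
      Runs (Prog.seq p q) s s'' (t + t')
  | ite_true {e : Expr} {p q : Prog} {s s' : Memory} {t : ℕ} (he : e.value s ≠ 0)
      (hp : Runs p s s' t) : Runs (Prog.ite e p q) s s' (e.steps + 1 + t)
  | ite_false {e : Expr} {p q : Prog} {s s' : Memory} {t : ℕ} (he : e.value s = 0)
      (hq : Runs q s s' t) : Runs (Prog.ite e p q) s s' (e.steps + 1 + t)
  | loop_true {e : Expr} {p : Prog} {s s' s'' : Memory} {t t' : ℕ} (he : e.value s ≠ 0)
      (hp : Runs p s s' t) (hl : Runs (Prog.loop e p) s' s'' t') :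
      Runs (Prog.loop e p) s s'' (e.steps + 1 + t + t')
  | loop_false {e : Expr} {p : Prog} {s : Memory} (he : e.value s = 0) :
      Runs (Prog.loop e p) s s (e.steps + 1)

namespace VRAP

/-- The initial memory for an instance with unit costs: the variables `0` and `1` hold `|U|` and
`|W|`, the array `0` is the adjacency matrix of `G`, stored row by row, the array `1` is the
indicator vector of the vulnerable machines, and everything else is zero. -/
def initialMemory (I : VRAP) : Memory where
  var x := if x = 0 then I.jobs else if x = 1 then I.machines else 0
  arr a i :=
    if a = 0 then
      if ∃ (u : Fin I.jobs) (w : Fin I.machines),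
        i = (u : ℕ) * I.machines + (w : ℕ) ∧ I.adj u w = true then 1 else 0
    else if a = 1 then
      if ∃ w ∈ I.vulnerable, i = (w : ℕ) then 1 else 0
    else 0

/-- The set of machines that a final memory describes: those with a non-zero entry in the
array `2`. -/
def outputSet (I : VRAP) (s : Memory) : Finset (Fin I.machines) :=
  Finset.univ.filter fun w => s.arr 2 w ≠ 0

end VRAP

end NodeRobust

/-! Write n = |U|. For a machine w not covered by μ, the set R_w consists of the jobs from which w
is reached by repeatedly taking an edge to a matched machine and passing to its partner
(`mem_coverSet_iff`). In a feasible uniform instance every job reaches some free machine, since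
otherwise the jobs that reach none would violate Hall's condition after one deletion
(`IsFeasible.exists_reaches`). Conversely, a set that contains all matched machines and, for each
job, a free machine it reaches is robust (`isRobust_of_reaches`). So the greedy cover never gets
stuck and its output is feasible.

For the ratio, let S be the set of uncovered jobs when the maximum gain first drops to at most 1.
Earlier steps cover at least two jobs each, later ones at least one, so the output has at most n +
(n - |S|)/2 + |S| machines (`GreedyCover.exists_independent`). A robust Y satisfies |Y| ≥ n. Also
|Y| ≥ 2|S|: each job has two neighbours in Y, and the neighbourhood of any machine lies in some R_w
with w free, hence meets S at most once. Together these give 3/2 + 1/4 = 7/4.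

For the running time, the program uses only counting loops bounded by |U| or |W|, so a polynomial
time bound follows from the syntax (`Code.exists_runs`). The matching is found by an auction in
which every round raises the total price by one; prices never exceed |U| because a perfect matching
exists (`IsAuctionState.price_lt_jobs`). Reachability stabilises after |U| rounds
(`Reaches.reachLevel_jobs`), and |U| greedy rounds suffice because each useful one covers a new job
(`greedy_spec`). -/

namespace NodeRobust

namespace VRAP

/-! ### Alternating reachability of a machine from a job -/

variable (I : VRAP)

/-- `u` is joined to `w` by an `M`-alternating walk with at most `k` edges outside `M`, all of whose
inner machines are covered by the matching `μ`. -/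
def ReachLevel (μ : Fin I.jobs → Fin I.machines) (w : Fin I.machines) :
    ℕ → Fin I.jobs → Prop
  | 0, _ => False
  | k + 1, u => I.adj u w = true ∨ ∃ u', I.adj u (μ u') = true ∧ ReachLevel μ w k u'

/-- `u` is joined to `w` by an `M`-alternating walk with inner machines covered by `μ`. -/
def Reaches (μ : Fin I.jobs → Fin I.machines) (w : Fin I.machines) (u : Fin I.jobs) : Prop :=
  ∃ k, I.ReachLevel μ w k u

variable {I}
variable {μ : Fin I.jobs → Fin I.machines} {w : Fin I.machines}

theorem Reaches.of_adj {u : Fin I.jobs} (h : I.adj u w = true) : I.Reaches μ w u :=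
  ⟨1, Or.inl h⟩

theorem Reaches.step {u u' : Fin I.jobs} (h : I.adj u (μ u') = true) (h' : I.Reaches μ w u') :
    I.Reaches μ w u := by
  obtain ⟨k, hk⟩ := h'
  exact ⟨k + 1, Or.inr ⟨u', h, hk⟩⟩

theorem Reaches.induction {p : Fin I.jobs → Prop} (hadj : ∀ u, I.adj u w = true → p u)
    (hstep : ∀ u u', I.adj u (μ u') = true → p u' → p u) {u : Fin I.jobs}
    (h : I.Reaches μ w u) : p u := by
  obtain ⟨k, hk⟩ := h
  induction k generalizing u with
  | zero => exact hk.elim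
  | succ k ih =>
    rcases hk with hk | ⟨u', h1, h2⟩
    · exact hadj u hk
    · exact hstep u u' h1 (ih h2)

theorem ReachLevel.succ {k : ℕ} {u : Fin I.jobs} (h : I.ReachLevel μ w k u) :
    I.ReachLevel μ w (k + 1) u := by
  induction k generalizing u with
  | zero => exact h.elim
  | succ k ih =>
    rcases h with h | ⟨u', h1, h2⟩
    · exact Or.inl h
    · exact Or.inr ⟨u', h1, ih h2⟩

/-! ### Cover sets as reachability sets -/

@[simp] theorem graph_adj_inl_inr (u : Fin I.jobs) (w : Fin I.machines) :
    I.graph.Adj (Sum.inl u) (Sum.inr w) ↔ I.adj u w = true := by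
  simp [graph]

@[simp] theorem graph_adj_inr_inl (u : Fin I.jobs) (w : Fin I.machines) :
    I.graph.Adj (Sum.inr w) (Sum.inl u) ↔ I.adj u w = true := by
  simp [graph]

@[simp] theorem not_graph_adj_inl_inl (u u' : Fin I.jobs) :
    ¬ I.graph.Adj (Sum.inl u) (Sum.inl u') := by
  simp [graph]

@[simp] theorem not_graph_adj_inr_inr (w w' : Fin I.machines) :
    ¬ I.graph.Adj (Sum.inr w) (Sum.inr w') := by
  simp [graph]

@[simp] theorem mem_matchingEdges {u : Fin I.jobs} {w : Fin I.machines} :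
    s(Sum.inl u, Sum.inr w) ∈ I.matchingEdges μ ↔ μ u = w := by
  simp [matchingEdges]

/-- A shortest alternating walk is a path. The level bounds on the vertices of `p` are carried
through the induction to show that newly prepended vertices are not yet on `p`. Prefixing the
matching edge at `u` to the chain records that `p` starts outside the matching, which is what allows
further prepending. -/
theorem exists_alternating_path_of_reachLevel {ν : Finset (Fin I.machines)}
    (hμ : I.IsPerfectMatching ν μ)
    (hw : w ∉ Set.range μ) (k : ℕ) {u : Fin I.jobs} (h : I.ReachLevel μ w (k + 1) u) :
    ∃ p : I.graph.Walk (Sum.inl u) (Sum.inr w), p.IsPath ∧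
      ((s(Sum.inl u, Sum.inr (μ u)) :: p.edges).IsChain
        fun e e' => (e ∈ I.matchingEdges μ ↔ e' ∉ I.matchingEdges μ)) ∧
      (∀ w', Sum.inr w' ∈ p.support → w' ∈ Set.range μ ∨ w' = w) ∧
      (∀ u', Sum.inl u' ∈ p.support → I.ReachLevel μ w (k + 1) u') ∧
      (∀ u', Sum.inr (μ u') ∈ p.support → I.ReachLevel μ w k u') := by
  have hw' : ∀ u, μ u ≠ w := fun u e => hw ⟨u, e⟩
  have base : ∀ (k : ℕ) (u : Fin I.jobs), I.adj u w = true →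
    ∃ p : I.graph.Walk (Sum.inl u) (Sum.inr w), p.IsPath ∧
      ((s(Sum.inl u, Sum.inr (μ u)) :: p.edges).IsChain
        fun e e' => (e ∈ I.matchingEdges μ ↔ e' ∉ I.matchingEdges μ)) ∧
      (∀ w', Sum.inr w' ∈ p.support → w' ∈ Set.range μ ∨ w' = w) ∧
      (∀ u', Sum.inl u' ∈ p.support → I.ReachLevel μ w (k + 1) u') ∧
      (∀ u', Sum.inr (μ u') ∈ p.support → I.ReachLevel μ w k u') := by
    intro k u h
    refine ⟨SimpleGraph.Walk.cons ((graph_adj_inl_inr u w).2 h) SimpleGraph.Walk.nil, ?_, ?_, ?_,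
      ?_, ?_⟩
    · simp
    · simp [hw']
    · simp
    · rintro u' hu'
      simp at hu'
      subst hu'
      exact Or.inl h
    · simp [hw']
  induction k generalizing u with
  | zero =>
    rcases h with h | ⟨u', -, h⟩
    · exact base 0 u h
    · exact h.elim
  | succ k ih =>
    -- Only a job that is not reached at a lower level gets a longer path. Both freshness claims
    -- below would otherwise put `u` on level `k + 1`.
    by_cases hk : I.ReachLevel μ w (k + 1) u
    · obtain ⟨p, h1, h2, h3, h4, h5⟩ := ih hk
      exact ⟨p, h1, h2, h3, fun u' hu' => (h4 u' hu').succ, fun u' hu' => (h5 u' hu').succ⟩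
    · rcases h with h | ⟨u', hadj, h⟩
      · exact base _ u h
      obtain ⟨p, h1, h2, h3, h4, h5⟩ := ih h
      have hne : μ u ≠ μ u' := by
        intro e
        rw [hμ.1 e] at hk
        exact hk h
      have hu : Sum.inl u ∉ p.support := fun hu => hk (h4 u hu)
      have hu' : Sum.inr (μ u') ∉ p.support := fun hu => hk (Or.inr ⟨u', hadj, h5 u' hu⟩)
      refine ⟨SimpleGraph.Walk.cons ((graph_adj_inl_inr u (μ u')).2 hadj)
        (SimpleGraph.Walk.cons ((graph_adj_inr_inl u' (μ u')).2 (hμ.2 u').1) p), ?_, ?_, ?_, ?_, ?_⟩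
      · simp [h1, hu, hu']
      · simp only [SimpleGraph.Walk.edges_cons]
        rw [Sym2.eq_swap (a := Sum.inr (μ u'))]
        simp [h2, hne]
      · intro w' hw'
        simp at hw'
        rcases hw' with rfl | hw'
        · exact Or.inl ⟨u', rfl⟩
        · exact h3 w' hw'
      · intro v hv
        simp at hv
        rcases hv with rfl | hv
        · exact Or.inr ⟨u', hadj, h⟩
        · exact (h4 v hv).succ
      · intro v hv
        simp at hv
        rcases hv with hv | hv
        · rw [hμ.1 hv]
          exact h
        · exact (h5 v hv).succ

/-- The last edge ends at the free machine `w`, so it is outside the matching; alternation then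
determines all other edges, and the induction peels off two at a time. The second conclusion forces
the edge leaving an inner machine to be its matching edge, so no condition on the inner machines is
needed. -/
theorem reaches_of_alternating_path (hw : w ∉ Set.range μ) {u : Fin I.jobs}
    (p : I.graph.Walk (Sum.inl u) (Sum.inr w)) (hp : I.IsAlternatingPath (I.matchingEdges μ) p)  :
    I.Reaches μ w u ∧ ∀ e ∈ p.edges.head?, e ∉ I.matchingEdges μ := by
  have hw' : ∀ u, μ u ≠ w := fun u e => hw ⟨u, e⟩
  induction hn : p.length using Nat.strong_induction_on generalizing u with
  | _ n ih =>
  obtain ⟨hp, hc⟩ := hp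
  cases p with
  | @cons _ b _ h p =>
    rcases b with u1 | w1
    · exact absurd h (not_graph_adj_inl_inl _ _)
    rw [graph_adj_inl_inr] at h
    cases p with
    | nil => exact ⟨Reaches.of_adj h, by simp [hw']⟩
    | @cons _ b _ h' p =>
      rcases b with u2 | w2
      swap
      · exact absurd h' (not_graph_adj_inr_inr _ _)
      simp only [SimpleGraph.Walk.edges_cons] at hc
      rw [List.isChain_cons_cons] at hc
      have hc2 : p.edges.IsChain fun e e' =>
          (e ∈ I.matchingEdges μ ↔ e' ∉ I.matchingEdges μ) := hc.2.tail
      obtain ⟨h1, h2⟩ := ih p.length (by simp at hn; omega) p ⟨by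
        simp at hp; exact hp.1.1, hc2⟩ rfl
      have h3 : s(Sum.inr w1, Sum.inl u2) ∈ I.matchingEdges μ := by
        cases p with
        | cons h'' p =>
          simp only [SimpleGraph.Walk.edges_cons] at hc h2
          have := hc.2
          rw [List.isChain_cons_cons] at this
          exact this.1.2 (h2 _ (by simp))
      refine ⟨?_, ?_⟩
      · rw [Sym2.eq_swap, mem_matchingEdges] at h3
        rw [← h3] at h
        exact Reaches.step h h1
      · simp only [SimpleGraph.Walk.edges_cons, List.head?_cons, Option.mem_def,
          Option.some.injEq, forall_eq']
        exact fun hm => (hc.1.1 hm) h3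

theorem mem_coverSet_iff {X : Finset (Fin I.machines)} (hμ : I.IsPerfectMatching X μ)
    (hw : w ∉ Set.range μ) {u : Fin I.jobs} : u ∈ I.coverSet μ w ↔ I.Reaches μ w u := by
  simp only [coverSet, Finset.mem_filter, Finset.mem_univ, true_and]
  constructor
  · rintro ⟨p, hp, -⟩
    exact (reaches_of_alternating_path hw p hp).1
  · rintro ⟨k, hk⟩
    obtain ⟨p, h1, h2, h3, -⟩ := exists_alternating_path_of_reachLevel hμ hw k hk.succ
    exact ⟨p, ⟨h1, h2.tail⟩, h3⟩

/-! ### Robustness of matchings extended by covers -/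

theorem IsFeasible.exists_isPerfectMatching (hu : I.IsUniform) (hf : I.IsFeasible) :
    ∃ μ, I.IsPerfectMatching Finset.univ μ := by
  obtain ⟨X, hX⟩ := hf
  rcases Nat.eq_zero_or_pos I.jobs with h | h
  · have : IsEmpty (Fin I.jobs) := by rw [h]; infer_instance
    exact ⟨fun u => isEmptyElim u, fun u => isEmptyElim u, fun u => isEmptyElim u⟩
  · obtain ⟨μ, hμ⟩ := hX ⟨0, h.trans_le I.jobs_le_machines⟩ (by rw [hu]; simp)
    exact ⟨μ, hμ.1, fun u => ⟨(hμ.2 u).1, Finset.mem_univ _⟩⟩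

/-- Let S be the set of jobs that reach no free machine. A neighbour of S is matched, and its
partner is again in S, so all neighbours of S lie in μ(S). Deleting `μ u` for some `u` in S leaves
|S| - 1 machines for S, contradicting robustness. -/
theorem IsFeasible.exists_reaches (hu : I.IsUniform) (hf : I.IsFeasible)
    (hμ : I.IsPerfectMatching Finset.univ μ) (u : Fin I.jobs) :
    ∃ w, w ∉ Set.range μ ∧ I.Reaches μ w u := by
  classical
  by_contra hcon
  set S : Finset (Fin I.jobs) :=
    Finset.univ.filter fun u => ¬ ∃ w, w ∉ Set.range μ ∧ I.Reaches μ w u with hS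
  have huS : u ∈ S := by simpa [hS] using hcon
  obtain ⟨X, hX⟩ := hf
  obtain ⟨ν, hν, hν'⟩ := hX (μ u) (by rw [hu]; simp)
  have hsub : S.image ν ⊆ (S.image μ).erase (μ u) := by
    intro x hx
    obtain ⟨v, hv, rfl⟩ := Finset.mem_image.1 hx
    have hv' : ¬ ∃ w, w ∉ Set.range μ ∧ I.Reaches μ w v := by simpa [hS] using hv
    refine Finset.mem_erase.2 ⟨(Finset.mem_erase.1 (hν' v).2).1, ?_⟩
    by_cases hr : ν v ∈ Set.range μ
    · obtain ⟨v', hv''⟩ := hr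
      refine Finset.mem_image.2 ⟨v', ?_, hv''⟩
      simp only [hS, Finset.mem_filter, Finset.mem_univ, true_and]
      rintro ⟨w, hw, hr⟩
      exact hv' ⟨w, hw, Reaches.step (by rw [hv'']; exact (hν' v).1) hr⟩
    · exact absurd ⟨ν v, hr, Reaches.of_adj (hν' v).1⟩ hv'
  have h1 := Finset.card_le_card hsub
  rw [Finset.card_erase_of_mem (Finset.mem_image_of_mem _ huS),
    Finset.card_image_of_injective _ hν, Finset.card_image_of_injective _ hμ.1] at h1
  have := Finset.card_pos.2 ⟨u, huS⟩
  omega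

/-- Hall's condition is checked in place of switching along an alternating path. If `f` is not in
μ(S), then μ(S) itself suffices; if it is, one machine is lost and `key` supplies a replacement. -/
theorem isRobust_of_reaches (hμ : I.IsPerfectMatching Finset.univ μ)
    {X : Finset (Fin I.machines)} (hX : ∀ u, μ u ∈ X)
    (hcov : ∀ u, ∃ w ∈ X, w ∉ Set.range μ ∧ I.Reaches μ w u) : I.IsRobust X := by
  classical
  intro f _
  -- An alternating walk that starts in S and ends at a free machine has a first machine outside
  -- μ(S), and the job before it still lies in S.
  have key : ∀ (S : Finset (Fin I.jobs)) (w : Fin I.machines), w ∈ X → w ∉ Set.range μ →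
      ∀ u, I.Reaches μ w u → u ∈ S →
        ∃ v ∈ S, ∃ x ∈ X, x ∉ S.image μ ∧ I.adj v x = true := by
    intro S w hwX hw u hr
    refine Reaches.induction (p := fun u => u ∈ S → ∃ v ∈ S, ∃ x ∈ X, x ∉ S.image μ ∧
      I.adj v x = true) ?_ ?_ hr
    · intro u hu huS
      refine ⟨u, huS, w, hwX, ?_, hu⟩
      simp only [Finset.mem_image, not_exists, not_and]
      exact fun v _ e => hw ⟨v, e⟩
    · intro u u' hadj ih huS
      by_cases h : u' ∈ S
      · exact ih h
      · refine ⟨u, huS, μ u', hX u', ?_, hadj⟩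
        simp only [Finset.mem_image, not_exists, not_and]
        exact fun v hv e => h (hμ.1 e ▸ hv)
  obtain ⟨ν, hν, hν'⟩ := (Finset.all_card_le_biUnion_card_iff_exists_injective
    fun u => (X.erase f).filter fun w => I.adj u w = true).1 (by
      intro S
      by_cases hf : f ∈ S.image μ
      · obtain ⟨u, huS, rfl⟩ := Finset.mem_image.1 hf
        obtain ⟨w, hwX, hw, hr⟩ := hcov u
        obtain ⟨v, hv, x, hx, hxS, hadj⟩ := key S w hwX hw u hr huS
        have hsub : insert x ((S.image μ).erase (μ u)) ⊆
            S.biUnion fun u' => (X.erase (μ u)).filter fun w => I.adj u' w = true := by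
          intro y hy
          rw [Finset.mem_biUnion]
          rcases Finset.mem_insert.1 hy with rfl | hy
          · refine ⟨v, hv, Finset.mem_filter.2 ⟨Finset.mem_erase.2 ⟨?_, hx⟩, hadj⟩⟩
            rintro rfl
            exact hxS hf
          · obtain ⟨h1, h2⟩ := Finset.mem_erase.1 hy
            obtain ⟨u', hu', rfl⟩ := Finset.mem_image.1 h2
            exact ⟨u', hu', Finset.mem_filter.2 ⟨Finset.mem_erase.2 ⟨h1, hX u'⟩, (hμ.2 u').1⟩⟩
        refine le_trans ?_ (Finset.card_le_card hsub)
        rw [Finset.card_insert_of_notMem (fun h => hxS (Finset.mem_of_mem_erase h)),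
          Finset.card_erase_of_mem hf, Finset.card_image_of_injective _ hμ.1]
        omega
      · rw [← Finset.card_image_of_injective S hμ.1]
        refine Finset.card_le_card fun y hy => ?_
        obtain ⟨u', hu', rfl⟩ := Finset.mem_image.1 hy
        refine Finset.mem_biUnion.2 ⟨u', hu', Finset.mem_filter.2
          ⟨Finset.mem_erase.2 ⟨?_, hX u'⟩, (hμ.2 u').1⟩⟩
        rintro rfl
        exact hf hy)
  exact ⟨ν, hν, fun u => ⟨(Finset.mem_filter.1 (hν' u)).2, (Finset.mem_filter.1 (hν' u)).1⟩⟩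

theorem IsRobust.jobs_le_card (hu : I.IsUniform) {Y : Finset (Fin I.machines)}
    (hY : I.IsRobust Y) : I.jobs ≤ Y.card := by
  rcases Nat.eq_zero_or_pos I.jobs with h | h
  · omega
  · obtain ⟨μ, hμ⟩ := hY ⟨0, h.trans_le I.jobs_le_machines⟩ (by rw [hu]; simp)
    have := Finset.card_le_card_of_injOn (s := Finset.univ) (t := Y) μ
      (fun u _ => Finset.mem_of_mem_erase (hμ.2 u).2) hμ.1.injOn
    simpa using this

theorem IsRobust.one_lt_card_neighbors (hu : I.IsUniform) {Y : Finset (Fin I.machines)}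
    (hY : I.IsRobust Y) (u : Fin I.jobs) : 1 < (Y.filter fun w => I.adj u w = true).card := by
  have hm : 0 < I.machines := (Fin.pos u).trans_le I.jobs_le_machines
  obtain ⟨μ, -, hμ⟩ := hY ⟨0, hm⟩ (by rw [hu]; simp)
  obtain ⟨ν, -, hν⟩ := hY (μ u) (by rw [hu]; simp)
  refine Finset.one_lt_card.2 ⟨μ u, ?_, ν u, ?_, (Finset.mem_erase.1 (hν u).2).1.symm⟩
  · exact Finset.mem_filter.2 ⟨Finset.mem_of_mem_erase (hμ u).2, (hμ u).1⟩
  · exact Finset.mem_filter.2 ⟨Finset.mem_of_mem_erase (hν u).2, (hν u).1⟩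

/-! ### Analysis of the greedy cover -/

theorem GreedyCover.subset {m n : ℕ} {R : Fin n → Finset (Fin m)} {T : Finset (Fin m)}
    {X Y : Finset (Fin n)} (h : GreedyCover R T X Y) : X ⊆ Y := by
  induction h with
  | done X => exact Finset.Subset.refl _
  | step T X Y w hT hw hmax h ih => exact (Finset.subset_insert _ _).trans ih

theorem GreedyCover.covers {m n : ℕ} {R : Fin n → Finset (Fin m)} {T : Finset (Fin m)}
    {X Y : Finset (Fin n)} (h : GreedyCover R T X Y) {u : Fin m} (hu : u ∈ T) :
    ∃ w ∈ Y, w ∉ X ∧ u ∈ R w := by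
  induction h with
  | done X => simp at hu
  | step T X Y w hT hw hmax h ih =>
    by_cases huw : u ∈ R w
    · exact ⟨w, h.subset (Finset.mem_insert_self _ _), hw, huw⟩
    · obtain ⟨w', h1, h2, h3⟩ := ih (Finset.mem_sdiff.2 ⟨hu, huw⟩)
      exact ⟨w', h1, fun h => h2 (Finset.mem_insert_of_mem h), h3⟩

theorem GreedyCover.gain_pos {m n : ℕ} {R : Fin n → Finset (Fin m)} {T : Finset (Fin m)}
    {X : Finset (Fin n)} (hcov : ∀ u ∈ T, ∃ w, w ∉ X ∧ u ∈ R w) {w : Fin n} (hT : T.Nonempty)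
    (hmax : ∀ w', w' ∉ X → (R w' ∩ T).card ≤ (R w ∩ T).card) : 0 < (R w ∩ T).card := by
  obtain ⟨u, hu⟩ := hT
  obtain ⟨w', hw', huw⟩ := hcov u hu
  exact (Finset.card_pos.2 ⟨u, Finset.mem_inter.2 ⟨huw, hu⟩⟩).trans_le (hmax w' hw')

theorem card_sdiff_add_card_inter' {m : ℕ} (R T : Finset (Fin m)) :
    (T \ R).card + (R ∩ T).card = T.card := by
  rw [Finset.inter_comm]
  exact Finset.card_sdiff_add_card_inter T R

theorem covered_after_step {m n : ℕ} {R : Fin n → Finset (Fin m)} {T : Finset (Fin m)}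
    {X : Finset (Fin n)} (hcov : ∀ u ∈ T, ∃ w, w ∉ X ∧ u ∈ R w) (w : Fin n) :
    ∀ u ∈ T \ R w, ∃ w', w' ∉ insert w X ∧ u ∈ R w' := by
  intro u hu
  obtain ⟨hu, hw⟩ := Finset.mem_sdiff.1 hu
  obtain ⟨w', h1, h2⟩ := hcov u hu
  refine ⟨w', ?_, h2⟩
  rw [Finset.mem_insert, not_or]
  exact ⟨by rintro rfl; exact hw h2, h1⟩

theorem GreedyCover.card_le {m n : ℕ} {R : Fin n → Finset (Fin m)} {T : Finset (Fin m)}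
    {X Y : Finset (Fin n)} (h : GreedyCover R T X Y)
    (hcov : ∀ u ∈ T, ∃ w, w ∉ X ∧ u ∈ R w) : Y.card ≤ X.card + T.card := by
  induction h with
  | done X => simp
  | step T X Y w hT hw hmax h ih =>
    have h1 := ih (covered_after_step hcov w)
    rw [Finset.card_insert_of_notMem hw] at h1
    have h2 := GreedyCover.gain_pos hcov hT hmax
    have h3 := card_sdiff_add_card_inter' (R w) T
    omega

/-- The set `S` consists of the jobs that are uncovered when the gain of a greedy step drops to at
most one. -/
theorem GreedyCover.exists_independent {m n : ℕ} {R : Fin n → Finset (Fin m)}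
    {T : Finset (Fin m)} {X Y : Finset (Fin n)} (h : GreedyCover R T X Y)
    (hcov : ∀ u ∈ T, ∃ w, w ∉ X ∧ u ∈ R w) :
    ∃ S ⊆ T, 2 * Y.card ≤ 2 * X.card + T.card + S.card ∧
      ∀ w, w ∉ X → (R w ∩ S).card ≤ 1 := by
  induction h with
  | done X => exact ⟨∅, by simp⟩
  | step T X Y w hT hw hmax h ih =>
    have h3 := card_sdiff_add_card_inter' (R w) T
    -- Once the maximum gain is at most one, all of `T` is taken as S and maximality bounds every
    -- unchosen machine. Before that, each step adds 2 to the left side and removes at least two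
    -- jobs from `T`.
    by_cases hg : (R w ∩ T).card ≤ 1
    · refine ⟨T, Finset.Subset.refl _, ?_, fun w' hw' => (hmax w' hw').trans hg⟩
      have := (GreedyCover.step T X Y w hT hw hmax h).card_le hcov
      omega
    · obtain ⟨S, hS, h1, h2⟩ := ih (covered_after_step hcov w)
      rw [Finset.card_insert_of_notMem hw] at h1
      refine ⟨S, hS.trans Finset.sdiff_subset, by omega, fun w' hw' => ?_⟩
      -- The induction hypothesis says nothing about the machine just chosen, but S avoids
      -- everything it covers.
      by_cases e : w' = w
      · subst e
        have : R w' ∩ S = ∅ := by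
          rw [← Finset.disjoint_iff_inter_eq_empty]
          exact Finset.disjoint_of_subset_right hS Finset.disjoint_sdiff
        simp [this]
      · exact h2 w' (by simp [e, hw'])

/-! ### The approximation guarantee -/

theorem totalCost_eq_card (hc : I.HasUnitCosts) (X : Finset (Fin I.machines)) :
    I.totalCost X = X.card := by
  simp [totalCost, hc _]

theorem isApproxSolution_of_isGreedyOutput (hu : I.IsUniform) (hc : I.HasUnitCosts)
    (hf : I.IsFeasible) {X : Finset (Fin I.machines)} (hX : I.IsGreedyOutput X) :
    I.IsApproxSolution (7 / 4) X := by
  classical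
  obtain ⟨μ, hμ, hg⟩ := hX
  have hfree : ∀ w, w ∉ Finset.univ.image μ ↔ w ∉ Set.range μ := by simp
  have hcov : ∀ u ∈ (Finset.univ : Finset (Fin I.jobs)),
      ∃ w, w ∉ Finset.univ.image μ ∧ u ∈ I.coverSet μ w := by
    intro u _
    obtain ⟨w, hw, hr⟩ := hf.exists_reaches hu hμ u
    exact ⟨w, (hfree w).2 hw, (mem_coverSet_iff hμ hw).2 hr⟩
  refine ⟨isRobust_of_reaches hμ (fun u => hg.subset (by simp)) fun u => ?_, fun Y hY => ?_⟩
  · obtain ⟨w, h1, h2, h3⟩ := hg.covers (Finset.mem_univ u)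
    rw [hfree] at h2
    exact ⟨w, h1, h2, (mem_coverSet_iff hμ h2).1 h3⟩
  · obtain ⟨S, -, h1, h2⟩ := hg.exists_independent hcov
    rw [Finset.card_image_of_injective _ hμ.1, Finset.card_univ, Fintype.card_fin] at h1
    have h3 := hY.jobs_le_card hu
    -- Double counting of the edges between S and Y: at least two at each job, at most one at each
    -- machine.
    have h4 : S.card * 2 ≤ Y.card * 1 := by
      refine Finset.card_mul_le_card_mul (fun u w => I.adj u w = true) ?_ ?_
      · intro u _
        exact hY.one_lt_card_neighbors hu u
      · intro y _
        -- A free `y` is its own witness. If `y = μ v`, any free machine reached from `v` is reached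
        -- from all neighbours of `y`.
        obtain ⟨w, hw, hsub⟩ : ∃ w, w ∉ Set.range μ ∧
            ∀ u, I.adj u y = true → I.Reaches μ w u := by
          by_cases hy : y ∈ Set.range μ
          · obtain ⟨v, rfl⟩ := hy
            obtain ⟨w, hw, hr⟩ := hf.exists_reaches hu hμ v
            exact ⟨w, hw, fun u h => Reaches.step h hr⟩
          · exact ⟨y, hy, fun u h => Reaches.of_adj h⟩
        refine (Finset.card_le_card fun u hu => ?_).trans (h2 w ((hfree w).2 hw))
        obtain ⟨hu1, hu2⟩ := Finset.mem_filter.1 hu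
        exact Finset.mem_inter.2 ⟨(mem_coverSet_iff hμ hw).2 (hsub u hu2), hu1⟩
    rw [totalCost_eq_card hc, totalCost_eq_card hc]
    -- 4|X| ≤ 6n + 2|S|, where n ≤ |Y| and 2|S| ≤ |Y|.
    have h5 : 4 * X.card ≤ 7 * Y.card := by omega
    have h6 : (4 : NNReal) * X.card ≤ 7 * Y.card := by exact_mod_cast h5
    rw [div_mul_eq_mul_div, le_div_iff₀ (by norm_num), mul_comm]
    exact h6

end VRAP

/-! ### Memories and programs with counting loops -/

namespace Memory

/-- Overwrite a variable. -/
def setVar (s : Memory) (x v : ℕ) : Memory := { s with var := Function.update s.var x v }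

/-- Overwrite a cell of an array. -/
def setCell (s : Memory) (a i v : ℕ) : Memory :=
  { s with arr := Function.update s.arr a (Function.update (s.arr a) i v) }

@[simp] theorem setVar_var (s : Memory) (x v y : ℕ) :
    (s.setVar x v).var y = if y = x then v else s.var y := by
  simp [setVar, Function.update_apply]

@[simp] theorem setVar_arr (s : Memory) (x v : ℕ) : (s.setVar x v).arr = s.arr := rfl

@[simp] theorem setCell_var (s : Memory) (a i v : ℕ) : (s.setCell a i v).var = s.var := rfl

@[simp] theorem setCell_arr (s : Memory) (a i v b j : ℕ) :
    (s.setCell a i v).arr b j = if b = a ∧ j = i then v else s.arr b j := by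
  by_cases h : b = a
  · subst h
    simp [setCell, Function.update_apply]
  · simp [setCell, h]

/-- The two memories agree outside the variables in `V` and the arrays in `A`. -/
def Agree (V A : List ℕ) (s s' : Memory) : Prop :=
  (∀ x ∉ V, s'.var x = s.var x) ∧ ∀ a ∉ A, s'.arr a = s.arr a

theorem Agree.refl (V A : List ℕ) (s : Memory) : Agree V A s s := ⟨fun _ _ => rfl, fun _ _ => rfl⟩

theorem Agree.trans {V A : List ℕ} {s s' s'' : Memory} (h : Agree V A s s')
    (h' : Agree V A s' s'') : Agree V A s s'' :=
  ⟨fun x hx => (h'.1 x hx).trans (h.1 x hx), fun a ha => (h'.2 a ha).trans (h.2 a ha)⟩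

theorem Agree.mono {V A V' A' : List ℕ} {s s' : Memory} (h : Agree V A s s') (hV : V ⊆ V')
    (hA : A ⊆ A') : Agree V' A' s s' :=
  ⟨fun x hx => h.1 x fun h => hx (hV h), fun a ha => h.2 a fun h => ha (hA h)⟩

end Memory

/-- Programs all of whose loops are counting loops: `count x b c` executes `c` for
`x = 0, 1, …` while `x` is less than the variable `b`. -/
inductive Code
  | skip
  | assign (x : ℕ) (e : Expr)
  | store (a : ℕ) (i e : Expr)
  | seq (c d : Code)
  | ite (e : Expr) (c d : Code)
  | count (x b : ℕ) (c : Code)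

namespace Code

/-- The program that executes the code. -/
def toProg : Code → Prog
  | skip => Prog.skip
  | assign x e => Prog.assign x e
  | store a i e => Prog.store a i e
  | seq c d => Prog.seq c.toProg d.toProg
  | ite e c d => Prog.ite e c.toProg d.toProg
  | count x b c => Prog.seq (Prog.assign x (Expr.const 0))
      (Prog.loop (Expr.lt (Expr.var x) (Expr.var b))
        (Prog.seq c.toProg (Prog.assign x (Expr.add (Expr.var x) (Expr.const 1)))))

/-- The memory after the execution of the code. -/
def run : Code → Memory → Memory
  | skip, s => s
  | assign x e, s => s.setVar x (e.value s)
  | store a i e, s => s.setCell a (i.value s) (e.value s)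
  | seq c d, s => d.run (c.run s)
  | ite e c d, s => if e.value s ≠ 0 then c.run s else d.run s
  | count x b c, s => Nat.rec (s.setVar x 0) (fun i s' => (c.run s').setVar x (i + 1)) (s.var b)

/-- The variables the code assigns to. -/
def vars : Code → List ℕ
  | skip => []
  | assign x _ => [x]
  | store _ _ _ => []
  | seq c d => c.vars ++ d.vars
  | ite _ c d => c.vars ++ d.vars
  | count x _ c => x :: c.vars

/-- The arrays the code stores to. -/
def arrs : Code → List ℕ
  | skip => []
  | assign _ _ => []
  | store a _ _ => [a]
  | seq c d => c.arrs ++ d.arrs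
  | ite _ c d => c.arrs ++ d.arrs
  | count _ _ c => c.arrs

/-- Every loop is bounded by one of the variables `0` and `1`, which are never changed, and no loop
changes its counter otherwise. -/
def WellFormed : Code → Prop
  | skip => True
  | assign x _ => 1 < x
  | store _ _ _ => True
  | seq c d => c.WellFormed ∧ d.WellFormed
  | ite _ c d => c.WellFormed ∧ d.WellFormed
  | count x b c => 1 < x ∧ b ≤ 1 ∧ x ∉ c.vars ∧ c.WellFormed

/-- A bound for the number of steps in terms of a bound for the variables `0` and `1`. -/
noncomputable def time : Code → Polynomial ℕ
  | skip => Polynomial.C 1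
  | assign _ e => Polynomial.C (e.steps + 1)
  | store _ i e => Polynomial.C (i.steps + e.steps + 1)
  | seq c d => c.time + d.time
  | ite e c d => Polynomial.C (e.steps + 1) + (c.time + d.time)
  | count _ _ c => Polynomial.C 6 + Polynomial.X * (c.time + Polynomial.C 8)

/-- The frame property: it reduces later non-interference claims to checks on lists of variable and
array numbers. -/
theorem agree_run (c : Code) (s : Memory) : Memory.Agree c.vars c.arrs s (c.run s) := by
  induction c generalizing s with
  | skip => exact Memory.Agree.refl _ _ _
  | assign x e =>
    refine ⟨fun y hy => ?_, fun _ _ => rfl⟩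
    simp only [vars, List.mem_singleton] at hy
    simp [run, hy]
  | store a i e =>
    refine ⟨fun _ _ => rfl, fun b hb => ?_⟩
    simp only [arrs, List.mem_singleton] at hb
    funext j
    simp [run, hb]
  | seq c d hc hd =>
    exact ((hc s).mono (List.subset_append_left _ _) (List.subset_append_left _ _)).trans
      ((hd _).mono (List.subset_append_right _ _) (List.subset_append_right _ _))
  | ite e c d hc hd =>
    simp only [run]
    split_ifs
    · exact (hc s).mono (List.subset_append_left _ _) (List.subset_append_left _ _)
    · exact (hd s).mono (List.subset_append_right _ _) (List.subset_append_right _ _)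
  | count x b c hc =>
    simp only [run]
    have hx : ∀ (s : Memory) (v : ℕ), Memory.Agree (x :: c.vars) c.arrs s (s.setVar x v) :=
      fun s v => ⟨fun y hy => by simp_all, fun _ _ => rfl⟩
    induction s.var b with
    | zero => exact hx _ _
    | succ i ih =>
      exact (ih.trans ((hc _).mono (List.subset_cons_self _ _) (List.Subset.refl _))).trans (hx _ _)

theorem WellFormed.notMem_vars {c : Code} (h : c.WellFormed) {b : ℕ} (hb : b ≤ 1) :
    b ∉ c.vars := by
  induction c with
  | skip => simp [vars]
  | assign x e => simp only [WellFormed] at h; simp [vars]; omega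
  | store a i e => simp [vars]
  | seq c d hc hd => simp [vars, hc h.1, hd h.2]
  | ite e c d hc hd => simp [vars, hc h.1, hd h.2]
  | count x _ c hc =>
    simp only [vars, List.mem_cons, not_or]
    exact ⟨by have := h.1; omega, hc h.2.2.2⟩

theorem WellFormed.var_run {c : Code} (h : c.WellFormed) {b : ℕ} (hb : b ≤ 1) (s : Memory) :
    (c.run s).var b = s.var b :=
  (c.agree_run s).1 b (h.notMem_vars hb)

/-- Termination and the time bound come from the syntax alone: the loop bounds are variables that
never change, so the total function `run` is realised by an actual execution. -/
theorem exists_runs {c : Code} (h : c.WellFormed) {N : ℕ} {s : Memory} (h0 : s.var 0 ≤ N)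
    (h1 : s.var 1 ≤ N) : ∃ t, Runs c.toProg s (c.run s) t ∧ t ≤ c.time.eval N := by
  induction c generalizing s with
  | skip => exact ⟨_, Runs.skip s, by simp [time]⟩
  | assign x e => exact ⟨_, Runs.assign x e s, by simp [time]⟩
  | store a i e => exact ⟨_, Runs.store a i e s, by simp [time]⟩
  | seq c d hc hd =>
    obtain ⟨t, ht, ht'⟩ := hc h.1 h0 h1
    obtain ⟨r, hr, hr'⟩ := hd h.2 (s := c.run s) (by rwa [h.1.var_run (by simp)])
      (by rwa [h.1.var_run (by simp)])
    exact ⟨_, Runs.seq ht hr, by simp [time]; omega⟩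
  | ite e c d hc hd =>
    simp only [run]
    split_ifs with he
    · obtain ⟨t, ht, ht'⟩ := hc h.1 h0 h1
      exact ⟨_, Runs.ite_true he ht, by simp [time]; omega⟩
    · obtain ⟨t, ht, ht'⟩ := hd h.2 h0 h1
      exact ⟨_, Runs.ite_false (not_not.1 he) ht, by simp [time]; omega⟩
  | count x b c hc =>
    obtain ⟨hx, hb, hxc, hwf⟩ := h
    have hbN : s.var b ≤ N := by
      interval_cases b <;> assumption
    let st : ℕ → Memory := fun n =>
      Nat.rec (s.setVar x 0) (fun i s' => (c.run s').setVar x (i + 1)) n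
    have hstep : ∀ i, st (i + 1) = (c.run (st i)).setVar x (i + 1) := fun i => rfl
    have hvar : ∀ i b', b' ≤ 1 → (st i).var b' = s.var b' := by
      intro i b' hb'
      have hne : b' ≠ x := by omega
      induction i with
      | zero => simp [st, hne]
      | succ i ih => rw [hstep]; simp [hne, hwf.var_run hb', ih]
    have hcnt : ∀ i, (st i).var x = i := by
      intro i
      cases i with
      | zero => simp [st]
      | succ i => rw [hstep]; simp
    -- Here `k` is the number of iterations left. A loop test costs 4 steps and an increment of the
    -- counter 4, hence 8 per iteration plus 4 for the failing test; the initial assignment costs 2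
    -- more.
    have main : ∀ k i, i + k = s.var b → ∃ t,
        Runs (Prog.loop (Expr.lt (Expr.var x) (Expr.var b))
          (Prog.seq c.toProg (Prog.assign x (Expr.add (Expr.var x) (Expr.const 1)))))
          (st i) (st (s.var b)) t ∧ t ≤ 4 + k * (c.time.eval N + 8) := by
      intro k
      induction k with
      | zero =>
        intro i hi
        simp only [add_zero] at hi
        rw [← hi]
        exact ⟨_, Runs.loop_false (by simp [Expr.value, hcnt, hvar _ _ hb, hi]),
          by simp [Expr.steps]⟩
      | succ k ih =>
        intro i hi
        obtain ⟨t, ht, ht'⟩ := hc hwf (s := st i) (by rwa [hvar _ _ (by simp)])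
          (by rwa [hvar _ _ (by simp)])
        obtain ⟨r, hr, hr'⟩ := ih (i + 1) (by omega)
        have ha : Runs (Prog.assign x (Expr.add (Expr.var x) (Expr.const 1))) (c.run (st i))
            (st (i + 1)) 4 := by
          have := Runs.assign x (Expr.add (Expr.var x) (Expr.const 1)) (c.run (st i))
          simp only [Expr.value, (c.agree_run (st i)).1 x hxc, hcnt] at this
          exact this
        refine ⟨_, Runs.loop_true (by simp [Expr.value, hcnt, hvar _ _ hb]; omega)
          (Runs.seq ht ha) hr, ?_⟩
        simp only [Expr.steps]
        rw [Nat.succ_mul]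
        omega
    obtain ⟨t, ht, ht'⟩ := main (s.var b) 0 (by simp)
    refine ⟨_, Runs.seq (Runs.assign x (Expr.const 0) s) ht, ?_⟩
    have := Nat.mul_le_mul_right (c.time.eval N + 8) hbN
    simp only [time, Expr.steps, Polynomial.eval_add, Polynomial.eval_mul, Polynomial.eval_C,
      Polynomial.eval_X]
    omega

/-- The invariant rule for counting loops. -/
theorem run_count {x b : ℕ} {c : Code} {s : Memory} (inv : ℕ → Memory → Prop)
    (hinit : inv 0 (s.setVar x 0))
    (hstep : ∀ i s', i < s.var b → Memory.Agree (x :: c.vars) c.arrs s s' → s'.var x = i →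
      inv i s' → inv (i + 1) ((c.run s').setVar x (i + 1))) :
    inv (s.var b) ((count x b c).run s) := by
  simp only [run]
  -- The induction also carries the frame property and the value of the counter, so that `hstep` may
  -- assume both.
  suffices h : ∀ i, i ≤ s.var b → ∀ s',
      s' = Nat.rec (motive := fun _ => Memory) (s.setVar x 0)
        (fun i s' => (c.run s').setVar x (i + 1)) i →
      Memory.Agree (x :: c.vars) c.arrs s s' ∧ s'.var x = i ∧ inv i s' from
    (h _ le_rfl _ rfl).2.2
  have hx : ∀ (s : Memory) (v : ℕ), Memory.Agree (x :: c.vars) c.arrs s (s.setVar x v) :=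
    fun s v => ⟨fun y hy => by simp_all, fun _ _ => rfl⟩
  intro i
  induction i with
  | zero =>
    rintro - s' rfl
    exact ⟨hx _ _, by simp, hinit⟩
  | succ i ih =>
    rintro hi s' rfl
    obtain ⟨h1, h2, h3⟩ := ih (by omega) _ rfl
    exact ⟨(h1.trans ((c.agree_run _).mono (List.subset_cons_self _ _) (List.Subset.refl _))).trans
      (hx _ _), by simp, hstep i _ (by omega) h1 h2 h3⟩

end Code

namespace VRAP

variable {I : VRAP}

/-! ### The auction algorithm for perfect matchings -/

/-- The invariant of the auction: `mate w` is `0` if the machine `w` is free and `u + 1` if it is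
matched to the job `u`; `assigned (u + 1)` tells whether the job `u` is matched; every matched job
is matched to a machine whose price is minimum up to one among its neighbours. -/
structure IsAuctionState (I : VRAP) (mate price assigned : ℕ → ℕ) : Prop where
  mate_spec : ∀ w : Fin I.machines, mate w = 0 ∨ ∃ u : Fin I.jobs, mate w = u + 1 ∧ I.adj u w = true
  mate_inj : ∀ w w' : Fin I.machines, mate w ≠ 0 → mate w = mate w' → w = w'
  assigned_spec : ∀ u : Fin I.jobs, assigned (u + 1) = 0 ↔ ∀ w : Fin I.machines, mate w ≠ u + 1
  price_free : ∀ w : Fin I.machines, mate w = 0 → price w = 0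
  slack : ∀ (w : Fin I.machines) (u : Fin I.jobs) (w' : Fin I.machines), mate w = u + 1 →
    I.adj u w' = true → price w ≤ price w' + 1
  price_le : ∀ w : Fin I.machines, price w ≤ I.jobs

namespace IsAuctionState

variable {mate price assigned : ℕ → ℕ}

/-- Let `S k` contain `u` and all jobs matched at price at least `k + 1`. For `k + 1 ≤ L`, slackness
makes `ν` send `S (k + 1)` to machines of price at least `k + 1`; these are matched, with owners in
`S k` other than `u`. So the sets shrink at every level up to `L`, where `u` is still present. -/
theorem price_lt_jobs (h : I.IsAuctionState mate price assigned)
    {ν : Fin I.jobs → Fin I.machines} (hν : I.IsPerfectMatching Finset.univ ν) {u : Fin I.jobs}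
    (hu : assigned (u + 1) = 0) {L : ℕ} (hL : ∀ w, I.adj u w = true → L ≤ price w) :
    L < I.jobs := by
  classical
  rw [h.assigned_spec] at hu
  let S : ℕ → Finset (Fin I.jobs) := fun k =>
    Finset.univ.filter fun v => v = u ∨ ∃ w : Fin I.machines, mate w = v + 1 ∧ k + 1 ≤ price w
  have huS : ∀ k, u ∈ S k := fun k => by simp [S]
  have hstep : ∀ k, k + 1 ≤ L → (S (k + 1)).card + 1 ≤ (S k).card := by
    intro k hk
    have hex : ∀ v ∈ S (k + 1), ∃ v' ∈ (S k).erase u, mate (ν v) = (v' : Fin I.jobs) + 1 := by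
      intro v hv
      have hp : k + 1 ≤ price (ν v) := by
        simp only [S, Finset.mem_filter, Finset.mem_univ, true_and] at hv
        rcases hv with rfl | ⟨w, hw, hk'⟩
        · exact hk.trans (hL _ (hν.2 v).1)
        · have := h.slack w v (ν v) hw (hν.2 v).1
          omega
      rcases h.mate_spec (ν v) with h0 | ⟨v', hv', -⟩
      · rw [h.price_free _ h0] at hp
        omega
      · refine ⟨v', Finset.mem_erase.2 ⟨?_, ?_⟩, hv'⟩
        · rintro rfl
          exact hu _ hv'
        · simp only [S, Finset.mem_filter, Finset.mem_univ, true_and]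
          exact Or.inr ⟨_, hv', hp⟩
    choose! f hf hf' using hex
    have hcard := Finset.card_le_card_of_injOn f hf (by
      intro v hv v' hv' e
      refine hν.1 (h.mate_inj _ _ ?_ ?_)
      · rw [hf' v hv]
        omega
      · rw [hf' v hv, hf' v' hv', e])
    rw [Finset.card_erase_of_mem (huS k)] at hcard
    have := Finset.card_pos.2 ⟨u, huS k⟩
    omega
  have hall : ∀ k, k ≤ L → (S k).card + k ≤ (S 0).card := by
    intro k
    induction k with
    | zero => simp
    | succ k ih =>
      intro hk
      have := ih (by omega)
      have := hstep k hk
      omega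
  have h1 := hall L le_rfl
  have h2 := Finset.card_pos.2 ⟨u, huS L⟩
  have h3 := Finset.card_le_univ (S 0)
  rw [Fintype.card_fin] at h3
  omega

/-- Slackness survives because `b` was cheapest for `u` and prices only rise; the price bound
survives by `price_lt_jobs`. If `b` was free, then `mate b = 0` and the evicted index is 0, which
encodes no job. -/
theorem bid (h : I.IsAuctionState mate price assigned)
    {ν : Fin I.jobs → Fin I.machines} (hν : I.IsPerfectMatching Finset.univ ν) {u : Fin I.jobs}
    (hu : assigned (u + 1) = 0) {b : Fin I.machines} (hb : I.adj u b = true)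
    (hmin : ∀ w, I.adj u w = true → price b ≤ price w) :
    I.IsAuctionState (fun w => if w = b then u + 1 else mate w)
      (fun w => if w = b then price b + 1 else price w)
      (fun v => if v = u + 1 then 1 else if v = mate b then 0 else assigned v) := by
  have hlt := h.price_lt_jobs hν hu hmin
  have hu' := (h.assigned_spec u).1 hu
  constructor
  · intro w
    by_cases e : w = b
    · subst e
      exact Or.inr ⟨u, by simp, hb⟩
    · simpa [Fin.val_inj, e] using h.mate_spec w
  · intro w w'
    by_cases e : w = b <;> by_cases e' : w' = b
    · simp [e, e']
    · simp only [e, Fin.val_inj, e']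
      intro _ h2
      exact absurd h2.symm (hu' w')
    · simp only [e', Fin.val_inj, e]
      intro _ h2
      exact absurd h2 (hu' w)
    · simpa [Fin.val_inj, e, e'] using h.mate_inj w w'
  · intro v
    by_cases e : v = u
    · subst e
      simp only [if_true, one_ne_zero, false_iff, not_forall]
      exact ⟨b, by simp⟩
    · have e1 : (v : ℕ) + 1 ≠ u + 1 := by simpa [Fin.val_inj] using e
      simp only [e1, if_false]
      split_ifs with e2
      · simp only [true_iff]
        intro w
        by_cases hw : w = b
        · simpa [hw] using e1.symm
        · simp only [Fin.val_inj, hw, if_false]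
          intro e3
          refine hw (h.mate_inj w b ?_ (e3.trans e2))
          omega
      · rw [h.assigned_spec]
        refine forall_congr' fun w => ?_
        by_cases hw : w = b
        · subst hw
          have e3 : (u : ℕ) ≠ v := fun e3 => e (Fin.ext e3.symm)
          simpa [e3] using Ne.symm e2
        · simp [Fin.val_inj, hw]
  · intro w
    by_cases e : w = b
    · simp [e]
    · simpa [Fin.val_inj, e] using h.price_free w
  · intro w v w' h1 h2
    have hle : price w' ≤ if (w' : ℕ) = b then price b + 1 else price w' := by
      split_ifs with e
      · rw [e]; omega
      · exact le_rfl
    by_cases e : w = b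
    · subst e
      simp only [if_true, add_left_inj, Fin.val_inj] at h1
      subst h1
      simp only [if_true]
      have := hmin w' h2
      omega
    · simp only [Fin.val_inj, e, if_false] at h1 ⊢
      have := h.slack w v w' h1 h2
      simp only [Fin.val_inj] at hle
      omega
  · intro w
    by_cases e : w = b
    · simp only [e, if_true]
      omega
    · simpa [Fin.val_inj, e] using h.price_le w

/-- Since |U| ≤ |W|, an unmatched job leaves some machine free, and a free machine has price 0. This
makes the inequality strict. -/
theorem sum_price_lt (h : I.IsAuctionState mate price assigned) {u : Fin I.jobs}
    (hu : assigned (u + 1) = 0) :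
    ∑ w : Fin I.machines, price w < I.machines * I.jobs := by
  classical
  rw [h.assigned_spec] at hu
  obtain ⟨w, hw⟩ : ∃ w : Fin I.machines, mate w = 0 := by
    by_contra! hcon
    have hex : ∀ w : Fin I.machines, ∃ v : Fin I.jobs, mate w = v + 1 := fun w =>
      ((h.mate_spec w).resolve_left (hcon w)).imp fun _ hv => hv.1
    choose f hf using hex
    have hc := Finset.card_le_card_of_injOn (s := Finset.univ) (t := Finset.univ.erase u) f
      (fun w _ => by
        simp only [Finset.coe_erase, Finset.coe_univ, Set.mem_sdiff, Set.mem_univ,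
          Set.mem_singleton_iff, true_and]
        rintro e
        exact hu w (e ▸ hf w))
      (fun w _ w' _ e => h.mate_inj w w' (hcon w) (by rw [hf, hf, e]))
    rw [Finset.card_erase_of_mem (Finset.mem_univ u)] at hc
    simp only [Finset.card_univ, Fintype.card_fin] at hc
    have := I.jobs_le_machines
    have := Fin.pos u
    omega
  calc ∑ w : Fin I.machines, price w < ∑ _w : Fin I.machines, I.jobs := by
        refine Finset.sum_lt_sum (fun w _ => h.price_le w) ⟨w, Finset.mem_univ _, ?_⟩
        rw [h.price_free w hw]
        exact Fin.pos u
    _ = I.machines * I.jobs := by simp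

theorem exists_isPerfectMatching (h : I.IsAuctionState mate price assigned)
    (ha : ∀ u : Fin I.jobs, assigned (u + 1) ≠ 0) :
    ∃ μ, I.IsPerfectMatching Finset.univ μ ∧
      ∀ (w : Fin I.machines) (u : Fin I.jobs), mate w = u + 1 ↔ μ u = w := by
  have hex : ∀ u : Fin I.jobs, ∃ w : Fin I.machines, mate w = u + 1 := by
    intro u
    by_contra! hcon
    exact ha u ((h.assigned_spec u).2 hcon)
  choose μ hμ using hex
  have hiff : ∀ (w : Fin I.machines) (u : Fin I.jobs), mate w = u + 1 ↔ μ u = w := by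
    intro w u
    constructor
    · intro hw
      exact h.mate_inj _ _ (by rw [hμ]; omega) (by rw [hμ, hw])
    · rintro rfl
      exact hμ u
  refine ⟨μ, ⟨fun u u' e => ?_, fun u => ⟨?_, Finset.mem_univ _⟩⟩, hiff⟩
  · have h1 := hμ u
    rw [e, hμ u'] at h1
    exact Fin.ext (by omega)
  · rcases h.mate_spec (μ u) with h0 | ⟨v, hv, hadj⟩
    · rw [hμ] at h0
      omega
    · rw [hμ] at hv
      obtain rfl : u = v := Fin.ext (by omega)
      exact hadj

end IsAuctionState

theorem sum_price_bid (price : ℕ → ℕ) {n : ℕ} (b : Fin n) :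
    ∑ w : Fin n, (if (w : ℕ) = b then price b + 1 else price w) = ∑ w : Fin n, price w + 1 := by
  have : ∀ w : Fin n, (if (w : ℕ) = b then price b + 1 else price w) =
      price w + if w = b then 1 else 0 := by
    intro w
    by_cases e : w = b <;> simp [e, Fin.val_inj]
  simp [this, Finset.sum_add_distrib]

/-- The levels grow strictly until the first repetition; a repeated level is closed under the
defining rules and hence contains every reaching job. -/
theorem Reaches.reachLevel_jobs {μ : Fin I.jobs → Fin I.machines} {w : Fin I.machines}
    {u : Fin I.jobs} (h : I.Reaches μ w u) : I.ReachLevel μ w I.jobs u := by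
  classical
  let S : ℕ → Finset (Fin I.jobs) := fun k => Finset.univ.filter fun u => I.ReachLevel μ w k u
  have key : ∀ k, k ≤ (S k).card ∨ ∀ u, I.Reaches μ w u → I.ReachLevel μ w k u := by
    intro k
    induction k with
    | zero => simp
    | succ k ih =>
      by_cases hall : ∀ u, I.Reaches μ w u → I.ReachLevel μ w k u
      · exact Or.inr fun u hu => (hall u hu).succ
      · left
        have hss : S k ⊂ S (k + 1) := by
          refine ⟨fun u hu => ?_, fun hsub => hall fun u hu => ?_⟩
          · simp only [S, Finset.mem_filter, Finset.mem_univ, true_and] at hu ⊢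
            exact hu.succ
          · have hsub' : ∀ u, I.ReachLevel μ w (k + 1) u → I.ReachLevel μ w k u := by
              intro u hu
              simpa [S] using hsub (show u ∈ S (k + 1) by simpa [S] using hu)
            exact hu.induction (fun u h => hsub' u (Or.inl h))
              fun u u' h h' => hsub' u (Or.inr ⟨u', h, h'⟩)
        have := Finset.card_lt_card hss
        have := ih.resolve_right hall
        omega
  rcases key I.jobs with hk | hk
  · have : S I.jobs = Finset.univ := by
      rw [← Finset.card_eq_iff_eq_univ, Fintype.card_fin]
      exact le_antisymm (by simpa using Finset.card_le_univ (S I.jobs)) hk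
    have hu : u ∈ S I.jobs := by simp [this]
    simpa [S] using hu
  · exact hk u h

end VRAP

/-! ### The program -/

namespace Code

/-- The index of the entry in row `u` and column `w` of a matrix; array `4` holds the offsets of the
rows. -/
def entry (u w : Expr) : Expr := Expr.add (Expr.cell 4 u) w

/-- Compute the offsets of the rows. -/
def rowOffsets : Code :=
  count 2 0 (store 4 (Expr.add (Expr.var 2) (Expr.const 1))
    (Expr.add (Expr.cell 4 (Expr.var 2)) (Expr.var 1)))

/-- Set the variable `5` to `u + 1` for an unassigned job `u`, and to `0` if there is none. -/
def findFreeJob : Code :=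
  seq (assign 5 (Expr.const 0))
    (count 6 0 (ite (Expr.cell 5 (Expr.add (Expr.var 6) (Expr.const 1))) skip
      (assign 5 (Expr.add (Expr.var 6) (Expr.const 1)))))

/-- Set the variable `7` to `w + 1` for a neighbour `w` of minimum price of the job given by the
variable `5`. -/
def findCheapest : Code :=
  seq (assign 7 (Expr.const 0))
    (count 8 1 (ite (Expr.cell 0 (entry (Expr.sub (Expr.var 5) (Expr.const 1)) (Expr.var 8)))
      (ite (Expr.var 7)
        (ite (Expr.lt (Expr.cell 3 (Expr.var 8))
            (Expr.cell 3 (Expr.sub (Expr.var 7) (Expr.const 1))))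
          (assign 7 (Expr.add (Expr.var 8) (Expr.const 1))) skip)
        (assign 7 (Expr.add (Expr.var 8) (Expr.const 1))))
      skip))

/-- Match the job given by the variable `5` to the machine given by the variable `7`, and raise the
price of that machine. -/
def placeBid : Code :=
  seq (store 5 (Expr.cell 2 (Expr.sub (Expr.var 7) (Expr.const 1))) (Expr.const 0))
    (seq (store 2 (Expr.sub (Expr.var 7) (Expr.const 1)) (Expr.var 5))
      (seq (store 5 (Expr.var 5) (Expr.const 1))
        (store 3 (Expr.sub (Expr.var 7) (Expr.const 1))
          (Expr.add (Expr.cell 3 (Expr.sub (Expr.var 7) (Expr.const 1))) (Expr.const 1)))))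

/-- One round of the auction. -/
def auctionRound : Code :=
  seq findFreeJob (ite (Expr.var 5) (seq findCheapest placeBid) skip)

/-- Compute a perfect matching. -/
def auction : Code := count 3 1 (count 4 1 auctionRound)

/-- Add row `u'` of the reachability matrix to the row given by the variable `9`, where `u'` is the
job matched to the machine given by the variable `10`. -/
def mergeRow : Code :=
  count 12 1 (ite (Expr.cell 6 (entry (Expr.sub (Expr.cell 2 (Expr.var 10)) (Expr.const 1))
      (Expr.var 12)))
    (store 6 (entry (Expr.var 9) (Expr.var 12)) (Expr.const 1)) skip)

/-- Use the edge given by the variables `9` and `10`. -/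
def useEdge : Code :=
  ite (Expr.cell 0 (entry (Expr.var 9) (Expr.var 10)))
    (seq (store 6 (entry (Expr.var 9) (Expr.var 10)) (Expr.const 1))
      (ite (Expr.cell 2 (Expr.var 10)) mergeRow skip))
    skip

/-- Compute the reachability matrix in the array `6`. -/
def reachability : Code := count 11 0 (count 9 0 (count 10 1 useEdge))

/-- Set the variable `16` to the number of uncovered jobs from which the machine given by the
variable `10` can be reached. -/
def computeGain : Code :=
  seq (assign 16 (Expr.const 0))
    (count 9 0 (ite (Expr.cell 7 (Expr.var 9)) skip
      (ite (Expr.cell 6 (entry (Expr.var 9) (Expr.var 10)))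
        (assign 16 (Expr.add (Expr.var 16) (Expr.const 1))) skip)))

/-- Set the variable `14` to an unchosen machine of maximum gain, and the variable `15` to its
gain. -/
def findBest : Code :=
  seq (assign 14 (Expr.const 0)) (seq (assign 15 (Expr.const 0))
    (count 10 1 (ite (Expr.cell 2 (Expr.var 10)) skip
      (seq computeGain (ite (Expr.lt (Expr.var 15) (Expr.var 16))
        (seq (assign 15 (Expr.var 16)) (assign 14 (Expr.var 10))) skip)))))

/-- Mark the jobs from which the machine given by the variable `14` can be reached. -/
def markCovered : Code :=
  count 9 0 (ite (Expr.cell 6 (entry (Expr.var 9) (Expr.var 14)))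
    (store 7 (Expr.var 9) (Expr.const 1)) skip)

/-- One step of the greedy cover. -/
def greedyStep : Code :=
  seq findBest (ite (Expr.var 15) (seq (store 2 (Expr.var 14) (Expr.const 1)) markCovered) skip)

/-- The greedy cover. -/
def greedy : Code := count 13 0 greedyStep

/-- The matching-and-greedy-cover algorithm. -/
def algorithm : Code := seq rowOffsets (seq auction (seq reachability greedy))

theorem wellFormed_algorithm : algorithm.WellFormed := by
  simp [algorithm, rowOffsets, auction, auctionRound, findFreeJob, findCheapest, placeBid,
    reachability, useEdge, mergeRow, greedy, greedyStep, findBest, computeGain, markCovered,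
    WellFormed, vars]

end Code

namespace VRAP

variable {I : VRAP}

/-! ### Correctness of the auction -/

/-- The memory contains the instance and the offsets of the rows. -/
structure IsReady (I : VRAP) (s : Memory) : Prop where
  jobs_eq : s.var 0 = I.jobs
  machines_eq : s.var 1 = I.machines
  row_eq : ∀ u : Fin I.jobs, s.arr 4 u = u * I.machines
  adj_iff : ∀ (u : Fin I.jobs) (w : Fin I.machines),
    s.arr 0 (u * I.machines + w) ≠ 0 ↔ I.adj u w = true

theorem IsReady.of_agree {s s' : Memory} (h : I.IsReady s) {V A : List ℕ}
    (ha : Memory.Agree V A s s') (h0 : 0 ∉ V) (h1 : 1 ∉ V) (h0' : 0 ∉ A) (h4 : 4 ∉ A) :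
    I.IsReady s' where
  jobs_eq := (ha.1 0 h0).trans h.jobs_eq
  machines_eq := (ha.1 1 h1).trans h.machines_eq
  row_eq u := by rw [ha.2 4 h4]; exact h.row_eq u
  adj_iff u w := by rw [ha.2 0 h0']; exact h.adj_iff u w

/-- Row-major indices do not collide, so memory cells identify matrix entries. -/
theorem entry_inj {n : ℕ} {u u' : ℕ} {w w' : Fin n} :
    u * n + w = u' * n + w' ↔ u = u' ∧ w = w' := by
  refine ⟨fun h => ?_, by rintro ⟨rfl, rfl⟩; rfl⟩
  have hn : 0 < n := Fin.pos w
  have h1 : (u * n + w) / n = u := by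
    rw [mul_comm, Nat.mul_add_div hn, Nat.div_eq_of_lt w.2, add_zero]
  have h2 : (u' * n + w') / n = u' := by
    rw [mul_comm, Nat.mul_add_div hn, Nat.div_eq_of_lt w'.2, add_zero]
  have h3 : u = u' := by rw [← h1, h, h2]
  subst h3
  exact ⟨rfl, Fin.ext (by omega)⟩

theorem isReady_rowOffsets : I.IsReady (Code.rowOffsets.run I.initialMemory) := by
  have ha := Code.rowOffsets.agree_run I.initialMemory
  have h := Code.run_count (x := 2) (b := 0)
    (c := Code.store 4 (Expr.add (Expr.var 2) (Expr.const 1))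
      (Expr.add (Expr.cell 4 (Expr.var 2)) (Expr.var 1))) (s := I.initialMemory)
    (fun i s => ∀ k ≤ i, s.arr 4 k = k * I.machines) (by
      intro k hk
      simp [initialMemory, Nat.le_zero.1 hk]) (by
      intro i s' _ ha hx hinv k hk
      have h1 : s'.var 1 = I.machines := ha.1 1 (by decide)
      by_cases e : k = i + 1
      · subst e
        simp [Code.run, Expr.value, hx, h1, hinv i le_rfl, Nat.succ_mul]
      · simpa [Code.run, Expr.value, hx, e] using hinv k (by omega))
  refine ⟨ha.1 0 (by decide), ha.1 1 (by decide), fun u => h u u.2.le, fun u w => ?_⟩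
  rw [ha.2 0 (by decide)]
  simp only [initialMemory, if_true, ne_eq, ite_eq_right_iff, one_ne_zero, imp_false, not_not]
  constructor
  · rintro ⟨u', w', e, hadj⟩
    obtain ⟨e1, e2⟩ := entry_inj.1 e
    rwa [Fin.ext e1, e2]
  · exact fun hadj => ⟨u, w, rfl, hadj⟩

theorem findFreeJob_spec {s : Memory} (h : I.IsReady s) :
    ((Code.findFreeJob.run s).var 5 = 0 ∧ ∀ u : Fin I.jobs, s.arr 5 (u + 1) ≠ 0) ∨
    ∃ u : Fin I.jobs, (Code.findFreeJob.run s).var 5 = u + 1 ∧ s.arr 5 (u + 1) = 0 := by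
  set s0 := s.setVar 5 0 with hs0
  have h0 : s0.var 0 = I.jobs := by simp [hs0, h.jobs_eq]
  have hl := Code.run_count (x := 6) (b := 0)
    (c := Code.ite (Expr.cell 5 (Expr.add (Expr.var 6) (Expr.const 1))) Code.skip
      (Code.assign 5 (Expr.add (Expr.var 6) (Expr.const 1)))) (s := s0)
    (fun i s' => (s'.var 5 = 0 ∧ ∀ u : Fin I.jobs, (u : ℕ) < i → s.arr 5 (u + 1) ≠ 0) ∨
      ∃ u : Fin I.jobs, s'.var 5 = u + 1 ∧ s.arr 5 (u + 1) = 0)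
    (by simp [hs0]) (by
      intro i s' hi ha hx hinv
      rw [h0] at hi
      have h5 : s'.arr 5 = s.arr 5 := ha.2 5 (by decide)
      simp only [Code.run, Expr.value, hx, h5]
      split_ifs with he
      · simp only [Memory.setVar_var, show (5 : ℕ) ≠ 6 by decide, if_false]
        refine hinv.imp (fun hinv => ⟨hinv.1, fun u hu => ?_⟩) id
        rcases Nat.lt_succ_iff_lt_or_eq.1 hu with hu | hu
        · exact hinv.2 u hu
        · rwa [hu]
      · exact Or.inr ⟨⟨i, hi⟩, by simp, by simpa using he⟩)
  rw [h0] at hl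
  exact hl.imp (fun hl => ⟨hl.1, fun u => hl.2 u u.2⟩) id

theorem findCheapest_spec {s : Memory} (h : I.IsReady s) {u : Fin I.jobs}
    (hu : s.var 5 = u + 1) (hex : ∃ w, I.adj u w = true) :
    ∃ b : Fin I.machines, (Code.findCheapest.run s).var 7 = b + 1 ∧ I.adj u b = true ∧
      ∀ w : Fin I.machines, I.adj u w = true → s.arr 3 b ≤ s.arr 3 w := by
  set s0 := s.setVar 7 0 with hs0
  have h1 : s0.var 1 = I.machines := by simp [hs0, h.machines_eq]
  have hl := Code.run_count (x := 8) (b := 1)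
    (c := Code.ite (Expr.cell 0 (Code.entry (Expr.sub (Expr.var 5) (Expr.const 1)) (Expr.var 8)))
      (Code.ite (Expr.var 7)
        (Code.ite (Expr.lt (Expr.cell 3 (Expr.var 8))
            (Expr.cell 3 (Expr.sub (Expr.var 7) (Expr.const 1))))
          (Code.assign 7 (Expr.add (Expr.var 8) (Expr.const 1))) Code.skip)
        (Code.assign 7 (Expr.add (Expr.var 8) (Expr.const 1))))
      Code.skip) (s := s0)
    (fun i s' => (s'.var 7 = 0 ∧ ∀ w : Fin I.machines, (w : ℕ) < i → ¬ I.adj u w = true) ∨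
      ∃ b : Fin I.machines, s'.var 7 = b + 1 ∧ I.adj u b = true ∧
      ∀ w : Fin I.machines, (w : ℕ) < i → I.adj u w = true → s.arr 3 b ≤ s.arr 3 w)
    (by simp [hs0]) (by
      intro i s' hi ha hx hinv
      rw [h1] at hi
      have h3 : s'.arr 3 = s.arr 3 := ha.2 3 (by decide)
      have h4 : s'.arr 4 = s.arr 4 := ha.2 4 (by decide)
      have h0 : s'.arr 0 = s.arr 0 := ha.2 0 (by decide)
      have h5 : s'.var 5 = u + 1 := (ha.1 5 (by decide)).trans (by simp [hs0, hu])
      have hlast : ∀ w : Fin I.machines, (w : ℕ) < i + 1 → (w : ℕ) < i ∨ w = ⟨i, hi⟩ :=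
        fun w hw => (Nat.lt_succ_iff_lt_or_eq.1 hw).imp id fun e => Fin.ext e
      have hadj := h.adj_iff u ⟨i, hi⟩
      simp only [Code.run, Code.entry, Expr.value, hx, h3, h4, h0, h5, Nat.add_sub_cancel,
        h.row_eq u]
      rw [if_congr hadj rfl rfl]
      by_cases e : I.adj u ⟨i, hi⟩ = true
      · rw [if_pos e]
        rcases hinv with ⟨hv, hall⟩ | ⟨b, hv, hb, hall⟩
        · refine Or.inr ⟨⟨i, hi⟩, by simp [hv], e, fun w hw hadj' => ?_⟩
          rcases hlast w hw with hw | rfl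
          · exact absurd hadj' (hall w hw)
          · exact le_rfl
        · simp only [hv, Nat.add_sub_cancel, ne_eq, Nat.add_eq_zero_iff, one_ne_zero, and_false,
            not_false_eq_true, if_true, ite_eq_right_iff, imp_false, not_not]
          by_cases hlt : s.arr 3 i < s.arr 3 b
          · rw [if_pos hlt]
            refine Or.inr ⟨⟨i, hi⟩, by simp, e, fun w hw hadj' => ?_⟩
            rcases hlast w hw with hw | rfl
            · exact hlt.le.trans (hall w hw hadj')
            · exact le_rfl
          · rw [if_neg hlt]
            refine Or.inr ⟨b, by simp [hv], hb, fun w hw hadj' => ?_⟩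
            rcases hlast w hw with hw | rfl
            · exact hall w hw hadj'
            · exact not_lt.1 hlt
      · rw [if_neg e]
        simp only [Memory.setVar_var, show (7 : ℕ) ≠ 8 by decide, if_false]
        refine hinv.imp (fun hinv => ⟨hinv.1, fun w hw => ?_⟩)
          (Exists.imp fun b hb => ⟨hb.1, hb.2.1, fun w hw hadj' => ?_⟩)
        · rcases hlast w hw with hw | rfl
          · exact hinv.2 w hw
          · exact e
        · rcases hlast w hw with hw | rfl
          · exact hb.2.2 w hw hadj'
          · exact absurd hadj' e)
  rw [h1] at hl
  rcases hl with ⟨-, hall⟩ | ⟨b, hv, hb, hall⟩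
  · obtain ⟨w, hw⟩ := hex
    exact absurd hw (hall w w.2)
  · exact ⟨b, hv, hb, fun w => hall w w.2⟩

/-- The sum of the prices counts the rounds: a round either finds every job assigned or places a
bid, which adds exactly one. -/
theorem auctionRound_spec {ν : Fin I.jobs → Fin I.machines}
    (hν : I.IsPerfectMatching Finset.univ ν) {s : Memory} (h : I.IsReady s)
    (hs : I.IsAuctionState (s.arr 2) (s.arr 3) (s.arr 5)) {k : ℕ}
    (hk : (∀ u : Fin I.jobs, s.arr 5 (u + 1) ≠ 0) ∨ k ≤ ∑ w : Fin I.machines, s.arr 3 w) :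
    let s' := Code.auctionRound.run s
    I.IsAuctionState (s'.arr 2) (s'.arr 3) (s'.arr 5) ∧
    ((∀ u : Fin I.jobs, s'.arr 5 (u + 1) ≠ 0) ∨ k + 1 ≤ ∑ w : Fin I.machines, s'.arr 3 w) := by
  intro s'
  set s1 := Code.findFreeJob.run s with hs1
  have ha1 : Memory.Agree Code.findFreeJob.vars Code.findFreeJob.arrs s s1 :=
    Code.findFreeJob.agree_run s
  have harr : s1.arr = s.arr := funext fun a => ha1.2 a (by simp [Code.arrs, Code.findFreeJob])
  have hs' : s' = if s1.var 5 ≠ 0 then Code.placeBid.run (Code.findCheapest.run s1) else s1 := rfl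
  rcases findFreeJob_spec h with ⟨h5, hall⟩ | ⟨u, h5, hu⟩
  · rw [hs', if_neg (by simpa using h5), harr]
    exact ⟨hs, Or.inl hall⟩
  · have hr1 : I.IsReady s1 := h.of_agree ha1 (by decide) (by decide) (by decide) (by decide)
    obtain ⟨b, h7, hb, hmin⟩ := findCheapest_spec hr1 h5 ⟨ν u, (hν.2 u).1⟩
    set s2 := Code.findCheapest.run s1 with hs2
    have ha2 : Memory.Agree Code.findCheapest.vars Code.findCheapest.arrs s1 s2 :=
      Code.findCheapest.agree_run s1
    have harr2 : s2.arr = s.arr :=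
      (funext fun a => ha2.2 a (by simp [Code.arrs, Code.findCheapest])).trans harr
    have h52 : s2.var 5 = u + 1 := (ha2.1 5 (by decide)).trans h5
    rw [if_pos (by rw [h5]; omega)] at hs'
    rw [harr] at hmin
    have hbid := hs.bid hν hu hb hmin
    have e2 : s'.arr 2 = fun w : ℕ => if w = (b : ℕ) then (u : ℕ) + 1 else s.arr 2 w := by
      funext w
      simp [hs', Code.placeBid, Code.run, Expr.value, h7, h52, harr2]
    have e3 : s'.arr 3 = fun w : ℕ => if w = (b : ℕ) then s.arr 3 b + 1 else s.arr 3 w := by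
      funext w
      simp [hs', Code.placeBid, Code.run, Expr.value, h7, harr2]
    have e5 : s'.arr 5 = fun v : ℕ => if v = (u : ℕ) + 1 then 1 else if v = s.arr 2 b then 0 else
        s.arr 5 v := by
      funext w
      simp [hs', Code.placeBid, Code.run, Expr.value, h7, h52, harr2]
    rw [e2, e3, e5]
    refine ⟨hbid, Or.inr ?_⟩
    rw [sum_price_bid]
    have := hk.resolve_left fun hall => hall u hu
    omega

theorem auction_spec {ν : Fin I.jobs → Fin I.machines}
    (hν : I.IsPerfectMatching Finset.univ ν) {s : Memory} (h : I.IsReady s)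
    (h2 : ∀ i, s.arr 2 i = 0) (h3 : ∀ i, s.arr 3 i = 0) (h5 : ∀ i, s.arr 5 i = 0) :
    ∃ μ, I.IsPerfectMatching Finset.univ μ ∧
      ∀ (w : Fin I.machines), ((Code.auction.run s).arr 2 w ≠ 0 → w ∈ Set.range μ) ∧
        ∀ u : Fin I.jobs, (Code.auction.run s).arr 2 w = u + 1 ↔ μ u = w := by
  let inv : ℕ → Memory → Prop := fun k s =>
    I.IsAuctionState (s.arr 2) (s.arr 3) (s.arr 5) ∧
    ((∀ u : Fin I.jobs, s.arr 5 (u + 1) ≠ 0) ∨ k ≤ ∑ w : Fin I.machines, s.arr 3 w)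
  have hinit : inv 0 s :=
    ⟨⟨fun w => Or.inl (h2 w), fun w _ hw => absurd (h2 w) hw, by simp [h2, h5],
      fun w _ => h3 w, by simp [h3], by simp [h3]⟩, by simp⟩
  -- Two nested loops give |W| * |W| rounds without multiplication. This is enough, since the price
  -- sum stays below |W| * |U| while a job is unassigned.
  have hl := Code.run_count (x := 3) (b := 1) (c := Code.count 4 1 Code.auctionRound) (s := s)
    (fun i s' => inv (i * I.machines) s') (by simpa [inv] using hinit) (by
      intro i s1 _ ha _ hinv
      have hr1 : I.IsReady s1 := h.of_agree ha (by decide) (by decide) (by decide) (by decide)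
      have hl := Code.run_count (x := 4) (b := 1) (c := Code.auctionRound) (s := s1)
        (fun j s' => inv (i * I.machines + j) s') (by simpa [inv] using hinv) (by
          intro j s2 _ ha _ hinv
          have hr2 : I.IsReady s2 :=
            hr1.of_agree ha (by decide) (by decide) (by decide) (by decide)
          exact auctionRound_spec hν hr2 hinv.1 hinv.2)
      rw [hr1.machines_eq] at hl
      show inv _ _
      rw [Nat.succ_mul]
      exact hl)
  rw [h.machines_eq] at hl
  change inv _ (Code.auction.run s) at hl
  set s' := Code.auction.run s
  obtain ⟨hst, hor⟩ := hl
  have hall : ∀ u : Fin I.jobs, s'.arr 5 (u + 1) ≠ 0 := by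
    rcases hor with hall | hsum
    · exact hall
    · intro u hu
      have h1 := hst.sum_price_lt hu
      have h2 := Nat.mul_le_mul_left I.machines I.jobs_le_machines
      omega
  obtain ⟨μ, hμ, hiff⟩ := hst.exists_isPerfectMatching hall
  refine ⟨μ, hμ, fun w => ⟨fun hw => ?_, hiff w⟩⟩
  obtain ⟨u, hu, -⟩ := (hst.mate_spec w).resolve_left hw
  exact ⟨u, (hiff w u).1 hu⟩

/-! ### Correctness of the reachability matrix -/

/-- The entry of the reachability matrix for the job `u` and the machine `w` is set. -/
def Marked (I : VRAP) (s : Memory) (u : Fin I.jobs) (w : Fin I.machines) : Prop :=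
  s.arr 6 (u * I.machines + w) ≠ 0

/-- The second reachability matrix has more marks than the first, and is sound if the first is. -/
def Extends (I : VRAP) (μ : Fin I.jobs → Fin I.machines) (s s' : Memory) : Prop :=
  (∀ u w, I.Marked s u w → I.Marked s' u w) ∧
    ((∀ u w, I.Marked s u w → I.Reaches μ w u) → ∀ u w, I.Marked s' u w → I.Reaches μ w u)

theorem marked_congr {s s' : Memory} (h : s'.arr 6 = s.arr 6) {u : Fin I.jobs}
    {w : Fin I.machines} : I.Marked s' u w ↔ I.Marked s u w := by
  simp [Marked, h]

theorem Extends.of_eq {μ : Fin I.jobs → Fin I.machines} {s s' : Memory}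
    (h : s'.arr 6 = s.arr 6) : I.Extends μ s s' := by
  simp only [Extends, marked_congr h, imp_self, implies_true, and_self]

theorem Extends.trans {μ : Fin I.jobs → Fin I.machines} {s s' s'' : Memory}
    (h : I.Extends μ s s') (h' : I.Extends μ s' s'') : I.Extends μ s s'' :=
  ⟨fun u w hm => h'.1 u w (h.1 u w hm), fun hs => h'.2 (h.2 hs)⟩

theorem marked_setCell {s : Memory} {u u' : Fin I.jobs} {w w' : Fin I.machines} :
    I.Marked (s.setCell 6 (u * I.machines + w) 1) u' w' ↔
      (u' = u ∧ w' = w) ∨ I.Marked s u' w' := by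
  simp only [Marked, Memory.setCell_arr, true_and, entry_inj, Fin.val_inj]
  by_cases h : u' = u ∧ w' = w <;> simp [h]

theorem Extends.setCell {μ : Fin I.jobs → Fin I.machines} {s : Memory} {u : Fin I.jobs}
    {w : Fin I.machines}
    (h : (∀ u w, I.Marked s u w → I.Reaches μ w u) → I.Reaches μ w u) :
    I.Extends μ s (s.setCell 6 (u * I.machines + w) 1) := by
  refine ⟨fun u' w' hm => marked_setCell.2 (Or.inr hm), fun hs u' w' hm => ?_⟩
  rcases marked_setCell.1 hm with ⟨rfl, rfl⟩ | hm
  · exact h hs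
  · exact hs u' w' hm

/-- The array `2` describes the matching `μ`. -/
def HoldsMatching (I : VRAP) (μ : Fin I.jobs → Fin I.machines) (s : Memory) : Prop :=
  ∀ w : Fin I.machines, (s.arr 2 w ≠ 0 → w ∈ Set.range μ) ∧
    ∀ u : Fin I.jobs, s.arr 2 w = u + 1 ↔ μ u = w

/-- Transfers to `u` the machines reached from `v` by one alternating step. Only marks present at
the start must be copied, so the matrix may be updated in place, even when `v = u`. -/
theorem mergeRow_spec {μ : Fin I.jobs → Fin I.machines} {s : Memory} (h : I.IsReady s)
    {u v : Fin I.jobs} (hu : s.var 9 = u) (hv : s.arr 2 (s.var 10) = v + 1)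
    (hadj : I.adj u (μ v) = true) :
    I.Extends μ s (Code.mergeRow.run s) ∧
      ∀ w, I.Marked s v w → I.Marked (Code.mergeRow.run s) u w := by
  have hl := Code.run_count (x := 12) (b := 1)
    (c := Code.ite (Expr.cell 6 (Code.entry (Expr.sub (Expr.cell 2 (Expr.var 10)) (Expr.const 1))
      (Expr.var 12)))
    (Code.store 6 (Code.entry (Expr.var 9) (Expr.var 12)) (Expr.const 1)) Code.skip) (s := s)
    (fun i s' => I.Extends μ s s' ∧
      ∀ w : Fin I.machines, (w : ℕ) < i → I.Marked s v w → I.Marked s' u w)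
    ⟨Extends.of_eq rfl, by simp⟩ (by
      intro i s' hi ha hx hinv
      rw [h.machines_eq] at hi
      have h10 : s'.var 10 = s.var 10 := ha.1 10 (by decide)
      have h9 : s'.var 9 = u := (ha.1 9 (by decide)).trans hu
      have h2 : s'.arr 2 = s.arr 2 := ha.2 2 (by decide)
      have h4 : s'.arr 4 = s.arr 4 := ha.2 4 (by decide)
      have hlast : ∀ w : Fin I.machines, (w : ℕ) < i + 1 → (w : ℕ) < i ∨ w = ⟨i, hi⟩ :=
        fun w hw => (Nat.lt_succ_iff_lt_or_eq.1 hw).imp id fun e => Fin.ext e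
      simp only [Code.run, Code.entry, Expr.value, hx, h10, h9, h2, h4, hv, Nat.add_sub_cancel,
        h.row_eq]
      split_ifs with hm
      · have hstep : I.Extends μ s' (s'.setCell 6 (u * I.machines + i) 1) :=
          Extends.setCell (w := ⟨i, hi⟩) fun hs => Reaches.step hadj (hs v ⟨i, hi⟩ hm)
        refine ⟨hinv.1.trans hstep, fun w hw hm' => ?_⟩
        rcases hlast w hw with hw | rfl
        · exact hstep.1 _ _ (hinv.2 w hw hm')
        · exact (marked_setCell (w := ⟨i, hi⟩)).2 (Or.inl ⟨rfl, rfl⟩)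
      · refine ⟨hinv.1, fun w hw hm' => ?_⟩
        rcases hlast w hw with hw | rfl
        · exact hinv.2 w hw hm'
        · exact absurd (hinv.1.1 _ _ hm') hm)
  rw [h.machines_eq] at hl
  exact ⟨hl.1, fun w => hl.2 w w.2⟩

theorem useEdge_spec {μ : Fin I.jobs → Fin I.machines} {s : Memory} (h : I.IsReady s)
    (hμ : I.HoldsMatching μ s) {u : Fin I.jobs} {x : Fin I.machines} (hu : s.var 9 = u)
    (hx : s.var 10 = x) :
    I.Extends μ s (Code.useEdge.run s) ∧ (I.adj u x = true →
      I.Marked (Code.useEdge.run s) u x ∧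
      ∀ v, μ v = x → ∀ w, I.Marked s v w → I.Marked (Code.useEdge.run s) u w) := by
  have hrun : Code.useEdge.run s = if I.adj u x = true then
      (if s.arr 2 x ≠ 0 then Code.mergeRow.run (s.setCell 6 (u * I.machines + x) 1)
        else s.setCell 6 (u * I.machines + x) 1) else s := by
    simp only [Code.useEdge, Code.run, Code.entry, Expr.value, hu, hx, h.row_eq]
    rw [if_congr (h.adj_iff u x) rfl rfl]
    simp [hx]
  rw [hrun]
  by_cases hadj : I.adj u x = true
  swap
  · simp only [hadj, Bool.false_eq_true, if_false, false_imp_iff, and_true]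
    exact Extends.of_eq rfl
  simp only [hadj, if_true, true_imp_iff]
  set s1 := s.setCell 6 (u * I.machines + x) 1 with hs1
  have hext : I.Extends μ s s1 := Extends.setCell fun _ => Reaches.of_adj hadj
  have hm1 : I.Marked s1 u x := marked_setCell.2 (Or.inl ⟨rfl, rfl⟩)
  have hr1 : I.IsReady s1 := by
    refine h.of_agree (V := []) (A := [6]) ⟨fun _ _ => rfl, fun a ha => ?_⟩ (by simp) (by simp)
      (by simp) (by simp)
    funext i
    simp only [List.mem_singleton] at ha
    simp [hs1, ha]
  split_ifs with h2
  · obtain ⟨v, hv⟩ := (hμ x).1 h2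
    have h2v : s1.arr 2 (s1.var 10) = v + 1 := by
      simp only [hs1, Memory.setCell_var, Memory.setCell_arr, hx]
      simpa using ((hμ x).2 v).2 hv
    obtain ⟨h3, h4⟩ := mergeRow_spec (μ := μ) hr1 (u := u) (v := v) (by simp [hs1, hu]) h2v
      (by rw [hv]; exact hadj)
    refine ⟨hext.trans h3, h3.1 _ _ hm1, fun v' hv' w hw => h4 w ?_⟩
    have e1 := ((hμ x).2 v).2 hv
    have e2 := ((hμ x).2 v').2 hv'
    have e3 : v' = v := Fin.ext (by omega)
    rw [← e3]
    exact hext.1 _ _ hw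
  · refine ⟨hext, hm1, fun v hv => ?_⟩
    have := ((hμ x).2 v).2 hv
    omega

/-- In-place updates can run ahead of the current round, so the invariant is two-sided: every mark
is sound, and after `i` rounds level `i` is marked. By `Reaches.reachLevel_jobs`, |U| rounds reach
everything. -/
theorem reachability_spec {μ : Fin I.jobs → Fin I.machines} {s : Memory} (h : I.IsReady s)
    (hμ : I.HoldsMatching μ s) (h6 : ∀ i, s.arr 6 i = 0) (u : Fin I.jobs) (w : Fin I.machines) :
    I.Marked (Code.reachability.run s) u w ↔ I.Reaches μ w u := by
  have hl := Code.run_count (x := 11) (b := 0)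
    (c := Code.count 9 0 (Code.count 10 1 Code.useEdge)) (s := s)
    (fun i s' => (∀ u w, I.Marked s' u w → I.Reaches μ w u) ∧
      ∀ u w, I.ReachLevel μ w i u → I.Marked s' u w)
    ⟨by simp [Marked, h6], by simp [ReachLevel]⟩ (by
      intro k s1 _ ha _ hinv
      have hr1 : I.IsReady s1 := h.of_agree ha (by decide) (by decide) (by decide) (by decide)
      have hm1 : I.HoldsMatching μ s1 := by
        simpa only [HoldsMatching, ha.2 2 (by decide)] using hμ
      have hl := Code.run_count (x := 9) (b := 0) (c := Code.count 10 1 Code.useEdge) (s := s1)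
        (fun i s' => I.Extends μ s1 s' ∧
          ∀ u : Fin I.jobs, (u : ℕ) < i → ∀ x : Fin I.machines,
            I.adj u x = true → I.Marked s' u x ∧
              ∀ v, μ v = x → ∀ w, I.Marked s1 v w → I.Marked s' u w)
        ⟨Extends.of_eq rfl, by simp⟩ (by
          intro i s2 hi ha hx2 hinv
          rw [hr1.jobs_eq] at hi
          have hr2 : I.IsReady s2 :=
            hr1.of_agree ha (by decide) (by decide) (by decide) (by decide)
          have hm2 : I.HoldsMatching μ s2 := by
            simpa only [HoldsMatching, ha.2 2 (by decide)] using hm1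
          have hl := Code.run_count (x := 10) (b := 1) (c := Code.useEdge) (s := s2)
            (fun j s' => I.Extends μ s2 s' ∧ ∀ x : Fin I.machines, (x : ℕ) < j →
              I.adj ⟨i, hi⟩ x = true → I.Marked s' ⟨i, hi⟩ x ∧
                ∀ v, μ v = x → ∀ w, I.Marked s2 v w → I.Marked s' ⟨i, hi⟩ w)
            ⟨Extends.of_eq rfl, by simp⟩ (by
              intro j s3 hj ha hx3 hinv
              rw [hr2.machines_eq] at hj
              have hr3 : I.IsReady s3 :=
                hr2.of_agree ha (by decide) (by decide) (by decide) (by decide)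
              have hm3 : I.HoldsMatching μ s3 := by
                simpa only [HoldsMatching, ha.2 2 (by decide)] using hm2
              obtain ⟨h1, h2⟩ := useEdge_spec hr3 hm3 (u := ⟨i, hi⟩) (x := ⟨j, hj⟩)
                ((ha.1 9 (by decide)).trans hx2) hx3
              have hset : I.Extends μ (Code.useEdge.run s3)
                  ((Code.useEdge.run s3).setVar 10 (j + 1)) := Extends.of_eq rfl
              refine ⟨(hinv.1.trans h1).trans hset, fun x hx hadj => ?_⟩
              rcases Nat.lt_succ_iff_lt_or_eq.1 hx with hx | hx
              · obtain ⟨h3, h4⟩ := hinv.2 x hx hadj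
                exact ⟨h1.1 _ _ h3, fun v hv w hw => h1.1 _ _ (h4 v hv w hw)⟩
              · obtain rfl : x = ⟨j, hj⟩ := Fin.ext hx
                exact ⟨(h2 hadj).1, fun v hv w hw => (h2 hadj).2 v hv w (hinv.1.1 _ _ hw)⟩)
          rw [hr2.machines_eq] at hl
          obtain ⟨h1, h2⟩ := hl
          set s4 := (Code.count 10 1 Code.useEdge).run s2
          have hset : I.Extends μ s4 (s4.setVar 9 (i + 1)) := Extends.of_eq rfl
          refine ⟨(hinv.1.trans h1).trans hset, fun u hu x hadj => ?_⟩
          rcases Nat.lt_succ_iff_lt_or_eq.1 hu with hu | hu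
          · obtain ⟨h3, h4⟩ := hinv.2 u hu x hadj
            exact ⟨h1.1 _ _ h3, fun v hv w hw => h1.1 _ _ (h4 v hv w hw)⟩
          · obtain rfl : u = ⟨i, hi⟩ := Fin.ext hu
            exact ⟨(h2 x x.2 hadj).1, fun v hv w hw =>
              (h2 x x.2 hadj).2 v hv w (hinv.1.1 _ _ hw)⟩)
      rw [hr1.jobs_eq] at hl
      obtain ⟨h1, h2⟩ := hl
      set s4 := (Code.count 9 0 (Code.count 10 1 Code.useEdge)).run s1
      refine ⟨h1.2 hinv.1, fun u w hlev => ?_⟩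
      rcases hlev with hadj | ⟨v, hadj, hlev⟩
      · exact (h2 u u.2 w hadj).1
      · exact (h2 u u.2 (μ v) hadj).2 v rfl w (hinv.2 v w hlev))
  rw [h.jobs_eq] at hl
  exact ⟨hl.1 u w, fun hr => hl.2 u w hr.reachLevel_jobs⟩

/-! ### Correctness of the greedy cover -/

/-- The jobs that are not marked as covered. -/
def uncovered (I : VRAP) (s : Memory) : Finset (Fin I.jobs) :=
  Finset.univ.filter fun u => s.arr 7 u = 0

open Classical in
/-- The jobs marked in the column `w` of the reachability matrix. -/
noncomputable def markedJobs (I : VRAP) (s : Memory) (w : Fin I.machines) : Finset (Fin I.jobs) :=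
  Finset.univ.filter fun u => I.Marked s u w

theorem mem_uncovered {s : Memory} {u : Fin I.jobs} : u ∈ I.uncovered s ↔ s.arr 7 u = 0 := by
  simp [uncovered]

theorem mem_markedJobs {s : Memory} {u : Fin I.jobs} {w : Fin I.machines} :
    u ∈ I.markedJobs s w ↔ I.Marked s u w := by
  simp [markedJobs]

theorem mem_outputSet {s : Memory} {w : Fin I.machines} : w ∈ I.outputSet s ↔ s.arr 2 w ≠ 0 := by
  simp [outputSet]

theorem uncovered_congr {s s' : Memory} (h : s'.arr 7 = s.arr 7) :
    I.uncovered s' = I.uncovered s := by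
  simp [uncovered, h]

theorem markedJobs_congr {s s' : Memory} (h : s'.arr 6 = s.arr 6) :
    I.markedJobs s' = I.markedJobs s := by
  funext w
  ext u
  rw [mem_markedJobs, mem_markedJobs, marked_congr h]

theorem outputSet_congr {s s' : Memory} (h : s'.arr 2 = s.arr 2) :
    I.outputSet s' = I.outputSet s := by
  simp [outputSet, h]

theorem computeGain_spec {s : Memory} (h : I.IsReady s) {w : Fin I.machines}
    (hw : s.var 10 = w) :
    (Code.computeGain.run s).var 16 = (I.markedJobs s w ∩ I.uncovered s).card := by
  classical
  set s0 := s.setVar 16 0 with hs0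
  have h0 : s0.var 0 = I.jobs := by simp [hs0, h.jobs_eq]
  have hl := Code.run_count (x := 9) (b := 0)
    (c := Code.ite (Expr.cell 7 (Expr.var 9)) Code.skip
      (Code.ite (Expr.cell 6 (Code.entry (Expr.var 9) (Expr.var 10)))
        (Code.assign 16 (Expr.add (Expr.var 16) (Expr.const 1))) Code.skip)) (s := s0)
    (fun i s' => s'.var 16 =
      ((I.markedJobs s w ∩ I.uncovered s).filter fun u : Fin I.jobs => (u : ℕ) < i).card)
    (by simp [hs0]) (by
      intro i s' hi ha hx hinv
      rw [h0] at hi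
      have h7 : s'.arr 7 = s.arr 7 := ha.2 7 (by decide)
      have h6 : s'.arr 6 = s.arr 6 := ha.2 6 (by decide)
      have h4 : s'.arr 4 = s.arr 4 := ha.2 4 (by decide)
      have h10 : s'.var 10 = w := (ha.1 10 (by decide)).trans hw
      have hrow : s.arr 4 i = i * I.machines := h.row_eq ⟨i, hi⟩
      have hlast : ∀ u : Fin I.jobs, (u : ℕ) < i + 1 ↔ u = ⟨i, hi⟩ ∨ (u : ℕ) < i := fun u => by
        rw [Fin.ext_iff]
        simp only
        omega
      have hrun : ((Code.run (Code.ite (Expr.cell 7 (Expr.var 9)) Code.skip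
          (Code.ite (Expr.cell 6 (Code.entry (Expr.var 9) (Expr.var 10)))
          (Code.assign 16 (Expr.add (Expr.var 16) (Expr.const 1))) Code.skip)) s').setVar 9
            (i + 1)).var 16 =
          if (⟨i, hi⟩ : Fin I.jobs) ∈ I.markedJobs s w ∩ I.uncovered s then s'.var 16 + 1
            else s'.var 16 := by
        simp only [Code.run, Code.entry, Expr.value, hx, h7, h6, h4, h10, hrow,
          Finset.mem_inter, mem_markedJobs, mem_uncovered, Marked]
        by_cases e1 : s.arr 7 i = 0 <;> by_cases e2 : s.arr 6 (i * I.machines + w) = 0 <;>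
          simp [e1, e2]
      rw [hrun, hinv]
      simp only [hlast, Finset.filter_or, Finset.filter_eq']
      split_ifs with hmem
      · rw [Finset.singleton_union, Finset.card_insert_of_notMem (by simp)]
      · simp)
  rw [h0] at hl
  refine hl.trans (congrArg Finset.card ?_)
  exact Finset.filter_true_of_mem fun u _ => u.2

/-- The comparison is strict and starts from 0, so a best gain of 0 leaves variable `14` at its
default, which then names no meaningful choice. -/
theorem findBest_spec {s : Memory} (h : I.IsReady s) :
    let s' := Code.findBest.run s
    (s'.var 15 = 0 ∨ ∃ w : Fin I.machines, w ∉ I.outputSet s ∧ s'.var 14 = w ∧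
      s'.var 15 = (I.markedJobs s w ∩ I.uncovered s).card) ∧
    ∀ w : Fin I.machines, w ∉ I.outputSet s →
      (I.markedJobs s w ∩ I.uncovered s).card ≤ s'.var 15 := by
  intro s'
  set s0 := (s.setVar 14 0).setVar 15 0 with hs0
  have h1 : s0.var 1 = I.machines := by simp [hs0, h.machines_eq]
  have hr0 : I.IsReady s0 := h.of_agree (V := [14, 15]) (A := [])
    ⟨fun x hx => by simp_all, fun _ _ => rfl⟩ (by simp) (by simp) (by simp) (by simp)
  have hl := Code.run_count (x := 10) (b := 1)
    (c := Code.ite (Expr.cell 2 (Expr.var 10)) Code.skip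
      (Code.seq Code.computeGain (Code.ite (Expr.lt (Expr.var 15) (Expr.var 16))
        (Code.seq (Code.assign 15 (Expr.var 16)) (Code.assign 14 (Expr.var 10))) Code.skip)))
    (s := s0)
    (fun i s' => (s'.var 15 = 0 ∨ ∃ w : Fin I.machines, w ∉ I.outputSet s ∧ s'.var 14 = w ∧
      s'.var 15 = (I.markedJobs s w ∩ I.uncovered s).card) ∧
      ∀ w : Fin I.machines, (w : ℕ) < i → w ∉ I.outputSet s →
        (I.markedJobs s w ∩ I.uncovered s).card ≤ s'.var 15)
    (by simp [hs0]) (by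
      intro i s1 hi ha hx hinv
      rw [h1] at hi
      have hr1 : I.IsReady s1 := hr0.of_agree ha (by decide) (by decide) (by decide) (by decide)
      have harr : s1.arr = s.arr :=
        funext fun a => ha.2 a (by simp [Code.arrs, Code.computeGain])
      have hlast : ∀ w : Fin I.machines, (w : ℕ) < i + 1 → (w : ℕ) < i ∨ w = ⟨i, hi⟩ :=
        fun w hw => (Nat.lt_succ_iff_lt_or_eq.1 hw).imp id fun e => Fin.ext e
      have hg := computeGain_spec hr1 (w := ⟨i, hi⟩) hx
      have hag := Code.computeGain.agree_run s1
      have h10 : (Code.computeGain.run s1).var 10 = i := (hag.1 10 (by decide)).trans hx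
      have h14 : (Code.computeGain.run s1).var 14 = s1.var 14 := hag.1 14 (by decide)
      have h15 : (Code.computeGain.run s1).var 15 = s1.var 15 := hag.1 15 (by decide)
      rw [markedJobs_congr (congrFun harr 6), uncovered_congr (congrFun harr 7)] at hg
      have hrun : (Code.ite (Expr.cell 2 (Expr.var 10)) Code.skip
          (Code.seq Code.computeGain (Code.ite (Expr.lt (Expr.var 15) (Expr.var 16))
            (Code.seq (Code.assign 15 (Expr.var 16)) (Code.assign 14 (Expr.var 10)))
            Code.skip))).run s1 =
          if (⟨i, hi⟩ : Fin I.machines) ∈ I.outputSet s then s1 else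
            if s1.var 15 < (I.markedJobs s ⟨i, hi⟩ ∩ I.uncovered s).card then
              ((Code.computeGain.run s1).setVar 15
                (I.markedJobs s ⟨i, hi⟩ ∩ I.uncovered s).card).setVar 14 i
            else Code.computeGain.run s1 := by
        simp only [mem_outputSet, Code.run, Expr.value, hx, harr, h15, hg, Memory.setVar_var, h10,
          show (10 : ℕ) ≠ 15 by decide, if_false]
        simp
      rw [hrun]
      split_ifs with e hc
      · refine ⟨by simpa using hinv.1, fun w hw hw' => ?_⟩
        rcases hlast w hw with hw | rfl
        · simpa using hinv.2 w hw hw'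
        · exact absurd e hw'
      · refine ⟨Or.inr ⟨⟨i, hi⟩, e, by simp, by simp⟩, fun w hw hw' => ?_⟩
        simp only [Memory.setVar_var, show (15 : ℕ) ≠ 10 by decide, show (15 : ℕ) ≠ 14 by decide,
          if_false, if_true]
        rcases hlast w hw with hw | rfl
        · exact (hinv.2 w hw hw').trans hc.le
        · exact le_rfl
      · refine ⟨by simpa [h14, h15] using hinv.1, fun w hw hw' => ?_⟩
        simp only [Memory.setVar_var, show (15 : ℕ) ≠ 10 by decide, if_false, h15]
        rcases hlast w hw with hw | rfl
        · exact hinv.2 w hw hw'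
        · exact not_lt.1 hc)
  rw [h1] at hl
  exact ⟨hl.1, fun w => hl.2 w w.2⟩

theorem markCovered_spec {s : Memory} (h : I.IsReady s) {w : Fin I.machines}
    (hw : s.var 14 = w) :
    I.uncovered (Code.markCovered.run s) = I.uncovered s \ I.markedJobs s w := by
  have hl := Code.run_count (x := 9) (b := 0)
    (c := Code.ite (Expr.cell 6 (Code.entry (Expr.var 9) (Expr.var 14)))
    (Code.store 7 (Expr.var 9) (Expr.const 1)) Code.skip) (s := s)
    (fun i s' => ∀ u : Fin I.jobs,
      s'.arr 7 u = 0 ↔ s.arr 7 u = 0 ∧ ¬ ((u : ℕ) < i ∧ I.Marked s u w))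
    (by simp) (by
      intro i s' hi ha hx hinv u
      rw [h.jobs_eq] at hi
      have h6 : s'.arr 6 = s.arr 6 := ha.2 6 (by decide)
      have h4 : s'.arr 4 = s.arr 4 := ha.2 4 (by decide)
      have h14 : s'.var 14 = w := (ha.1 14 (by decide)).trans hw
      have hrow : s.arr 4 i = i * I.machines := h.row_eq ⟨i, hi⟩
      simp only [Code.run, Code.entry, Expr.value, hx, h6, h4, h14, hrow]
      by_cases e : (u : ℕ) = i
      · have hm : I.Marked s u w ↔ s.arr 6 (i * I.machines + w) ≠ 0 := by rw [Marked, e]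
        rw [hm]
        split_ifs with hc
        · simp [e, hc]
        · have := hinv u
          rw [e] at this
          simpa [hc, e] using this
      · have hlt : (u : ℕ) < i + 1 ↔ (u : ℕ) < i := by omega
        rw [hlt, ← hinv u]
        split_ifs with hc
        · simp [e]
        · simp)
  rw [h.jobs_eq] at hl
  ext u
  rw [Finset.mem_sdiff, mem_uncovered, mem_uncovered, mem_markedJobs]
  refine (hl u).trans ?_
  simp

theorem greedyStep_spec {s : Memory} (h : I.IsReady s) :
    let s' := Code.greedyStep.run s
    ((∀ w, w ∉ I.outputSet s → (I.markedJobs s w ∩ I.uncovered s).card = 0) ∧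
      I.outputSet s' = I.outputSet s ∧ I.uncovered s' = I.uncovered s) ∨
    ∃ w, w ∉ I.outputSet s ∧ 0 < (I.markedJobs s w ∩ I.uncovered s).card ∧
      (∀ w', w' ∉ I.outputSet s → (I.markedJobs s w' ∩ I.uncovered s).card ≤
        (I.markedJobs s w ∩ I.uncovered s).card) ∧
      I.outputSet s' = insert w (I.outputSet s) ∧
      I.uncovered s' = I.uncovered s \ I.markedJobs s w := by
  intro s'
  obtain ⟨h1, h2⟩ := findBest_spec h
  have ha := Code.findBest.agree_run s
  set s1 := Code.findBest.run s with hs1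
  have harr : s1.arr = s.arr :=
    funext fun a => ha.2 a (by simp [Code.arrs, Code.findBest, Code.computeGain])
  have hr1 : I.IsReady s1 := h.of_agree ha (by decide) (by decide) (by decide) (by decide)
  -- The value 1 would also encode job 0 as a partner, but the greedy phase only tests whether
  -- entries of array `2` are zero.
  have hs' : s' = if s1.var 15 ≠ 0 then Code.markCovered.run (s1.setCell 2 (s1.var 14) 1)
      else s1 := rfl
  by_cases e : s1.var 15 = 0
  · rw [if_neg (by simpa using e)] at hs'
    refine Or.inl ⟨fun w hw => ?_, ?_, ?_⟩
    · have := h2 w hw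
      omega
    · exact outputSet_congr (by rw [hs', harr])
    · exact uncovered_congr (by rw [hs', harr])
  · obtain ⟨w, hw, h14, h15⟩ := h1.resolve_left e
    rw [if_pos e, h14] at hs'
    set s2 := s1.setCell 2 w 1 with hs2
    have hr2 : I.IsReady s2 := by
      refine hr1.of_agree (V := []) (A := [2]) ⟨fun _ _ => rfl, fun a ha => ?_⟩ (by simp) (by simp)
        (by simp) (by simp)
      funext i
      simp only [List.mem_singleton] at ha
      simp [hs2, ha]
    refine Or.inr ⟨w, hw, by omega, fun w' hw' => (h2 w' hw').trans h15.le, ?_, ?_⟩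
    · ext x
      have ha2 := (Code.markCovered.agree_run s2).2 2 (by decide)
      rw [Finset.mem_insert, mem_outputSet, mem_outputSet, hs', ha2]
      by_cases hx : x = w
      · simp [hs2, hx]
      · simp [hs2, hx, Fin.val_inj, harr]
    · rw [hs', markCovered_spec hr2 (w := w) (by simp [hs2, h14])]
      rw [uncovered_congr (s' := s2) (s := s), markedJobs_congr (s' := s2) (s := s)]
      · funext j
        simp [hs2, harr]
      · funext j
        simp [hs2, harr]

/-- Only sets of machines outside `X` are ever inspected. This matters because the computed columns
are identified with `coverSet` for free machines only. -/
theorem GreedyCover.congr {m n : ℕ} {R R' : Fin n → Finset (Fin m)} {T : Finset (Fin m)}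
    {X Y : Finset (Fin n)} (h : GreedyCover R T X Y) (hR : ∀ w, w ∉ X → R w = R' w) :
    GreedyCover R' T X Y := by
  induction h with
  | done X => exact GreedyCover.done X
  | step T X Y w hT hw hmax h ih =>
    refine GreedyCover.step T X Y w hT hw (fun w' hw' => ?_) ?_
    · rw [← hR w hw, ← hR w' hw']
      exact hmax w' hw'
    · rw [← hR w hw]
      exact ih fun w' hw' => hR w' fun h => hw' (Finset.mem_insert_of_mem h)

/-- The invariant is a continuation: any completion of the greedy cover from the current state is
one from the initial state. A useful round covers at least one job; an idle one means, by
coverability, that no job is left. So |U| rounds suffice. -/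
theorem greedy_spec {s : Memory} (h : I.IsReady s)
    (hcov : ∀ u ∈ I.uncovered s, ∃ w, w ∉ I.outputSet s ∧ u ∈ I.markedJobs s w) :
    GreedyCover (I.markedJobs s) (I.uncovered s) (I.outputSet s)
      (I.outputSet (Code.greedy.run s)) := by
  have hl := Code.run_count (x := 13) (b := 0) (c := Code.greedyStep) (s := s)
    (fun i s' => (∀ u ∈ I.uncovered s', ∃ w, w ∉ I.outputSet s' ∧ u ∈ I.markedJobs s w) ∧
      (I.uncovered s').card ≤ I.jobs - i ∧
      ∀ Y, GreedyCover (I.markedJobs s) (I.uncovered s') (I.outputSet s') Y →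
        GreedyCover (I.markedJobs s) (I.uncovered s) (I.outputSet s) Y)
    ⟨hcov, (Finset.card_le_univ (I.uncovered s)).trans (by simp), fun Y hY => hY⟩ (by
      intro i s1 _ ha _ hinv
      obtain ⟨hc, hcard, hg⟩ := hinv
      have hr1 : I.IsReady s1 := h.of_agree ha (by decide) (by decide) (by decide) (by decide)
      have hm : I.markedJobs s1 = I.markedJobs s := markedJobs_congr (ha.2 6 (by decide))
      have hstep := greedyStep_spec hr1
      simp only [hm] at hstep
      set s2 := Code.greedyStep.run s1
      have e1 : I.uncovered (s2.setVar 13 (i + 1)) = I.uncovered s2 := rfl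
      have e2 : I.outputSet (s2.setVar 13 (i + 1)) = I.outputSet s2 := rfl
      rw [e1, e2]
      rcases hstep with ⟨h0, hX, hT⟩ | ⟨w, hw, hpos, hmax, hX, hT⟩
      · rw [hX, hT]
        refine ⟨hc, ?_, hg⟩
        have : I.uncovered s1 = ∅ := by
          rw [Finset.eq_empty_iff_forall_notMem]
          intro u hu
          obtain ⟨w, hw, huw⟩ := hc u hu
          have := Finset.card_pos.2 ⟨u, Finset.mem_inter.2 ⟨huw, hu⟩⟩
          have := h0 w hw
          omega
        simp [this]
      · rw [hX, hT]
        refine ⟨covered_after_step hc w, ?_, fun Y hY => hg Y ?_⟩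
        · have := card_sdiff_add_card_inter' (I.markedJobs s w) (I.uncovered s1)
          omega
        · obtain ⟨u, hu⟩ := Finset.card_pos.1 hpos
          exact GreedyCover.step _ _ _ w ⟨u, (Finset.mem_inter.1 hu).2⟩ hw hmax hY)
  rw [h.jobs_eq] at hl
  obtain ⟨-, hcard, hg⟩ := hl
  change ∀ Y, GreedyCover _ (I.uncovered (Code.greedy.run s)) (I.outputSet (Code.greedy.run s)) Y →
    _ at hg
  change (I.uncovered (Code.greedy.run s)).card ≤ _ at hcard
  have he : I.uncovered (Code.greedy.run s) = ∅ := by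
    rw [← Finset.card_eq_zero]
    omega
  rw [he] at hg
  exact hg _ (GreedyCover.done _)

/-! ### Correctness of the whole program and the main theorem -/

theorem algorithm_spec (hu : I.IsUniform) (hf : I.IsFeasible) :
    I.IsGreedyOutput (I.outputSet (Code.algorithm.run I.initialMemory)) := by
  obtain ⟨ν, hν⟩ := hf.exists_isPerfectMatching hu
  have hrun : Code.algorithm.run I.initialMemory = Code.greedy.run (Code.reachability.run
    (Code.auction.run (Code.rowOffsets.run I.initialMemory))) := rfl
  rw [hrun]
  have ha1 := Code.rowOffsets.agree_run I.initialMemory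
  have hr1 : I.IsReady _ := isReady_rowOffsets
  set s1 := Code.rowOffsets.run I.initialMemory
  have hz1 : ∀ a, 2 ≤ a → a ≠ 4 → ∀ i, s1.arr a i = 0 := by
    intro a ha h4 i
    rw [ha1.2 a (by simpa [Code.arrs, Code.rowOffsets] using h4)]
    simp [initialMemory, show a ≠ 0 by omega, show a ≠ 1 by omega]
  obtain ⟨μ, hμ, hM2⟩ := auction_spec hν hr1 (hz1 2 (by simp) (by simp)) (hz1 3 (by simp) (by simp))
    (hz1 5 (by simp) (by simp))
  have ha2 := Code.auction.agree_run s1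
  set s2 := Code.auction.run s1
  have hr2 : I.IsReady s2 := hr1.of_agree ha2 (by decide) (by decide) (by decide) (by decide)
  have h26 : ∀ i, s2.arr 6 i = 0 := by
    rw [ha2.2 6 (by decide)]
    exact hz1 6 (by simp) (by simp)
  have hM : I.HoldsMatching μ s2 := hM2
  have hreach := reachability_spec hr2 hM h26
  have ha3 := Code.reachability.agree_run s2
  set s3 := Code.reachability.run s2
  have hr3 : I.IsReady s3 := hr2.of_agree ha3 (by decide) (by decide) (by decide) (by decide)
  have hX : I.outputSet s3 = Finset.univ.image μ := by
    ext w
    rw [mem_outputSet, ha3.2 2 (by decide)]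
    simp only [Finset.mem_image, Finset.mem_univ, true_and]
    refine ⟨(hM w).1, ?_⟩
    rintro ⟨u, hu⟩
    rw [((hM w).2 u).2 hu]
    omega
  have hT : I.uncovered s3 = Finset.univ := by
    ext u
    rw [mem_uncovered, ha3.2 7 (by decide), ha2.2 7 (by decide)]
    simp [hz1 7 (by simp) (by simp)]
  have hfree : ∀ w, w ∉ Finset.univ.image μ ↔ w ∉ Set.range μ := by simp
  have hg := greedy_spec hr3 (by
    intro u _
    obtain ⟨w, hw, hr⟩ := hf.exists_reaches hu hμ u
    exact ⟨w, by rwa [hX, hfree], mem_markedJobs.2 ((hreach u w).2 hr)⟩)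
  rw [hX, hT] at hg
  refine ⟨μ, hμ, hg.congr fun w hw => ?_⟩
  ext u
  rw [mem_markedJobs, hreach, mem_coverSet_iff hμ ((hfree w).1 hw)]

end VRAP

end NodeRobust

theorem mainTheorem5 :
    (∀ I : NodeRobust.VRAP, I.IsUniform → I.HasUnitCosts → I.IsFeasible →
      ∀ X : Finset (Fin I.machines), I.IsGreedyOutput X → I.IsApproxSolution (7 / 4) X) ∧
    ∃ (P : NodeRobust.Prog) (q : Polynomial ℕ),
      ∀ I : NodeRobust.VRAP, I.IsUniform → I.HasUnitCosts → I.IsFeasible →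
        ∃ (s : NodeRobust.Memory) (t : ℕ),
          NodeRobust.Runs P I.initialMemory s t ∧
          t ≤ q.eval (I.jobs + I.machines) ∧
          I.IsGreedyOutput (I.outputSet s) ∧
          I.IsApproxSolution (7 / 4) (I.outputSet s) := by
  refine ⟨fun I hu hc hf X hX => NodeRobust.VRAP.isApproxSolution_of_isGreedyOutput hu hc hf hX,
    NodeRobust.Code.algorithm.toProg, NodeRobust.Code.algorithm.time, fun I hu hc hf => ?_⟩
  obtain ⟨t, ht, ht'⟩ := NodeRobust.Code.exists_runs NodeRobust.Code.wellFormed_algorithm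
    (N := I.jobs + I.machines) (s := I.initialMemory) (by simp [NodeRobust.VRAP.initialMemory])
    (by simp [NodeRobust.VRAP.initialMemory])
  have hg := NodeRobust.VRAP.algorithm_spec hu hf
  exact ⟨_, t, ht, ht', hg, NodeRobust.VRAP.isApproxSolution_of_isGreedyOutput hu hc hf hg⟩
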